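/- Let $N\ge 0$ and $d\ge 2$ be integers, and let $\otimes$ denote throughout either the minimal or the maximal tensor product of $C^*$-algebras (the result holds for both). All $C^*$-algebras are unital. **Spheres.** Let $C(S^{N-1}_{\mathbb R,+})$ be the universal $C^*$-algebra generated by self-adjoint elements $x_1,\dots,x_N$ with $\sum_i x_i^2=1$. The polygonal spheres are as follows, where $(P_d)$ denotes the relations $x_{i_0}x_{i_1}\cdots x_{i_d}=0$ for all pairwise distinct indices $i_0,\dots,i_d$ (no condition if $d\ge N$): - $S^{N-1,d-1}_{\mathbb R}=\{x\in\mathbb R^N : \|x\|=1,\ x_{i_0}\cdots x_{i_d}=0 \text{ for all distinct } i_0,\dots,i_d\}$, with its algebra $C(S^{N-1,d-1}_{\mathbb R})$ of continuous complex functions and the usual coordinates $x_i$. - $\bar S^{N-1,d-1}_{\mathbb R}$, $S^{N-1,d-1}_{\mathbb R,*}$, $\bar S^{N-1,d-1}_{\mathbb R,*}$, $S^{N-1,d-1}_{\mathbb R,+}$: the universal $C^*$-algebras obtained from $C(S^{N-1}_{\mathbb R,+})$ by imposing $(P_d)$ and, respectively: $x_ix_j=-x_jx_i$ for $i\ne j$;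 $x_ix_jx_k=x_kx_jx_i$ for all $i,j,k$; $x_ix_jx_k=-x_kx_jx_i$ for $i,j,k$ distinct and $x_ix_jx_k=x_kx_jx_i$ otherwise; no further relation. **Quantum groups.** A closed quantum subgroup $G\subset O_N^+$ is given by a $C^*$-algebra $C(G)$ generated by self-adjoint elements $u_{ij}$ ($1\le i,j\le N$) with $\sum_k u_{ik}u_{jk}=\sum_k u_{ki}u_{kj}=\delta_{ij}$, such that $u_{ij}\mapsto\sum_k u_{ik}\otimes u_{kj}$ defines a morphism $C(G)\to C(G)\otimes C(G)$. Consider the following ones: - $H_N$: the group of $N\times N$ signed permutation matrices, with $C(H_N)$ its algebra of functions and $u_{ij}(U)=U_{ij}$. - $H_N^*$: $C(H_N^*)$ is the universal $C^*$-algebra generated by self-adjoint $u_{ij}$ satisfying the above orthogonality relations, $abc=cba$ for all $a,b,c\in\{u_{ij}\}$, and $ab=0$ whenever $a\ne b$ are entries on the same row or the same column of $u$. - $H_N^{[\infty]}$: $C(H_N^{[\infty]})$ is the universal $C^*$-algebra generated by self-adjoint $u_{ij}$ satisfying the above orthogonality relations and $abc=0$ for all $a,b,c\in\{u_{ij}\}$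 such that $a\ne c$ are entries on the same row or the same column of $u$. We say that $G$ acts on $X$ if there is a (unital) morphism of $C^*$-algebras $\Phi:C(X)\to C(G)\otimes C(X)$ with $\Phi(x_i)=\sum_j u_{ij}\otimes x_j$ for all $i$. **Theorem.** $H_N,\ H_N,\ H_N^*,\ H_N^*,\ H_N^{[\infty]}$ act respectively on $$S^{N-1,d-1}_{\mathbb R},\quad \bar S^{N-1,d-1}_{\mathbb R},\quad S^{N-1,d-1}_{\mathbb R,*},\quad \bar S^{N-1,d-1}_{\mathbb R,*},\quad S^{N-1,d-1}_{\mathbb R,+}.$$ -/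

import Mathlib

open scoped TensorProduct

noncomputable section

/-- A C*-seminorm on a complex *-algebra. -/
structure CStarSeminorm (F : Type*) [Ring F] [StarRing F] [Algebra ℂ F] extends Seminorm ℂ F where
  mul_le' : ∀ a b : F, toFun (a * b) ≤ toFun a * toFun b
  star_mul_self' : ∀ a : F, toFun (star a * a) = toFun a ^ 2

namespace CStarSeminorm

variable {F : Type*} [Ring F] [StarRing F] [Algebra ℂ F]

instance : CoeFun (CStarSeminorm F) (fun _ => F → ℝ) := ⟨fun p => p.toFun⟩

section basic
variable (p : CStarSeminorm F)

theorem nonneg (a : F) : 0 ≤ p a := apply_nonneg p.toSeminorm a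
theorem add_le (a b : F) : p (a + b) ≤ p a + p b := map_add_le_add p.toSeminorm a b
theorem zero_eq : p 0 = 0 := map_zero p.toSeminorm
theorem neg_eq (a : F) : p (-a) = p a := map_neg_eq_map p.toSeminorm a
theorem smul_eq (c : ℂ) (a : F) : p (c • a) = ‖c‖ * p a := map_smul_eq_mul p.toSeminorm c a

theorem star_le (a : F) : p a ≤ p (star a) := by
  have h : p a * p a ≤ p (star a) * p a := by
    have := p.mul_le' (star a) a
    rw [p.star_mul_self', sq] at this
    exact this
  rcases (p.nonneg a).eq_or_lt with h0 | h0
  · rw [← h0]; exact p.nonneg _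
  · exact le_of_mul_le_mul_right h h0

theorem star_eq (a : F) : p (star a) = p a :=
  le_antisymm (by simpa using p.star_le (star a)) (p.star_le a)

end basic

/-- The pointwise supremum of a pointwise bounded set of C*-seminorms. -/
def supOf (S : Set (CStarSeminorm F)) (hS : ∀ a : F, ∃ C : ℝ, ∀ p ∈ S, p a ≤ C) :
    CStarSeminorm F where
  toFun a := ⨆ p : S, p.1 a
  map_zero' := by simp [zero_eq]
  add_le' a b := by
    have bdd (a : F) : BddAbove (Set.range fun p : S => p.1 a) := by
      obtain ⟨C, hC⟩ := hS a; exact ⟨C, by rintro _ ⟨p, rfl⟩; exact hC p p.2⟩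
    rcases isEmpty_or_nonempty S with h | h
    · simp
    · exact ciSup_le fun p => (p.1.add_le a b).trans
        (add_le_add (le_ciSup (bdd a) p) (le_ciSup (bdd b) p))
  neg' a := by simp [neg_eq]
  smul' c a := by
    simp only [smul_eq]
    rw [Real.mul_iSup_of_nonneg (norm_nonneg c)]
  mul_le' a b := by
    have bdd (a : F) : BddAbove (Set.range fun p : S => p.1 a) := by
      obtain ⟨C, hC⟩ := hS a; exact ⟨C, by rintro _ ⟨p, rfl⟩; exact hC p p.2⟩
    rcases isEmpty_or_nonempty S with h | h
    · simp
    · exact ciSup_le fun p => (p.1.mul_le' a b).trans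
        (mul_le_mul (le_ciSup (bdd a) p) (le_ciSup (bdd b) p) (p.1.nonneg b)
          ((p.1.nonneg a).trans (le_ciSup (bdd a) p)))
  star_mul_self' a := by
    have bdd (a : F) : BddAbove (Set.range fun p : S => p.1 a) := by
      obtain ⟨C, hC⟩ := hS a; exact ⟨C, by rintro _ ⟨p, rfl⟩; exact hC p p.2⟩
    rcases isEmpty_or_nonempty S with h | h
    · simp
    · have h0 : 0 ≤ ⨆ p : S, p.1 a :=
        ((Classical.arbitrary S).1.nonneg a).trans (le_ciSup (bdd a) _)
      apply le_antisymm
      · refine ciSup_le fun p => ?_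
        rw [p.1.star_mul_self']
        exact pow_le_pow_left₀ (p.1.nonneg a) (le_ciSup (bdd a) p) 2
      · have : (⨆ p : S, p.1 a) ≤ √(⨆ p : S, p.1 (star a * a)) := by
          refine ciSup_le fun p => Real.le_sqrt_of_sq_le ?_
          rw [← p.1.star_mul_self']
          exact le_ciSup (bdd (star a * a)) p
        calc _ ≤ (√(⨆ p : S, p.1 (star a * a))) ^ 2 := pow_le_pow_left₀ h0 this 2
          _ = _ := Real.sq_sqrt (((Classical.arbitrary S).1.nonneg _).trans
            (le_ciSup (bdd (star a * a)) _))

theorem le_supOf {S : Set (CStarSeminorm F)} {hS : ∀ a : F, ∃ C : ℝ, ∀ p ∈ S, p a ≤ C}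
    {p : CStarSeminorm F} (hp : p ∈ S) (a : F) : p a ≤ supOf S hS a := by
  obtain ⟨C, hC⟩ := hS a
  exact le_ciSup (f := fun p : S => p.1 a) ⟨C, by rintro _ ⟨p, rfl⟩; exact hC p p.2⟩ ⟨p, hp⟩

/-- The C*-seminorm `a ↦ ‖φ a‖` defined by a *-homomorphism into a C*-algebra. -/
def ofHom {T : Type*} [CStarAlgebra T] (φ : F →⋆ₐ[ℂ] T) : CStarSeminorm F where
  toFun a := ‖φ a‖
  map_zero' := by simp
  add_le' a b := by simpa using norm_add_le _ _
  neg' a := by simp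
  smul' c a := by simp [norm_smul]
  mul_le' a b := by simpa using norm_mul_le _ _
  star_mul_self' a := by rw [map_mul, map_star, CStarRing.norm_star_mul_self, sq]

@[simp] theorem ofHom_apply {T : Type*} [CStarAlgebra T] (φ : F →⋆ₐ[ℂ] T) (a : F) :
    ofHom φ a = ‖φ a‖ := rfl

/-- The algebra `F`, regarded as a seminormed space by means of `p`. -/
def Pre (_ : CStarSeminorm F) : Type _ := F

section pre
variable (p : CStarSeminorm F)

instance : Ring p.Pre := inferInstanceAs (Ring F)
instance : StarRing p.Pre := inferInstanceAs (StarRing F)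
instance : Algebra ℂ p.Pre := inferInstanceAs (Algebra ℂ F)
instance [StarModule ℂ F] : StarModule ℂ p.Pre := inferInstanceAs (StarModule ℂ F)

instance : SeminormedRing p.Pre where
  __ : Ring p.Pre := inferInstance
  __ := p.toSeminorm.toAddGroupSeminorm.toSeminormedAddCommGroup
  norm_mul_le := p.mul_le'

theorem norm_pre (a : p.Pre) : ‖a‖ = p a := rfl

instance : NormedSpace ℂ p.Pre where
  norm_smul_le c a := (p.smul_eq c a).le

instance : NormedStarGroup p.Pre where
  norm_star_le a := (p.star_eq a).le

/-- The C*-algebra obtained from `F` by separation and completion with respect to the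
C*-seminorm `p`. -/
def Cpl : Type _ := UniformSpace.Completion p.Pre

instance : NormedRing p.Cpl := inferInstanceAs (NormedRing (UniformSpace.Completion p.Pre))
instance : CompleteSpace p.Cpl := inferInstanceAs (CompleteSpace (UniformSpace.Completion p.Pre))
instance : Algebra ℂ p.Cpl := inferInstanceAs (Algebra ℂ (UniformSpace.Completion p.Pre))
instance : NormedAlgebra ℂ p.Cpl where
  norm_smul_le c x := norm_smul_le (β := UniformSpace.Completion p.Pre) c x

instance : Star p.Cpl := ⟨UniformSpace.Completion.map (star : p.Pre → p.Pre)⟩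

theorem uniformContinuous_star_pre : UniformContinuous (star : p.Pre → p.Pre) :=
  (starNormedAddGroupHom : NormedAddGroupHom p.Pre p.Pre).uniformContinuous

/-- The canonical map of `F` into its completion. -/
def coe' (a : F) : p.Cpl := UniformSpace.Completion.coe' (α := p.Pre) a

theorem continuous_star_cpl : Continuous (star : p.Cpl → p.Cpl) :=
  UniformSpace.Completion.continuous_map

theorem star_coe' (a : F) : star (p.coe' a) = p.coe' (star a) :=
  UniformSpace.Completion.map_coe p.uniformContinuous_star_pre a

theorem denseRange_coe' : DenseRange p.coe' :=
  UniformSpace.Completion.denseRange_coe (α := p.Pre)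

theorem norm_coe' (a : F) : ‖p.coe' a‖ = p a :=
  UniformSpace.Completion.norm_coe (E := p.Pre) a

theorem coe'_add (a b : F) : p.coe' (a + b) = p.coe' a + p.coe' b :=
  UniformSpace.Completion.coe_add (α := p.Pre) a b

theorem coe'_mul (a b : F) : p.coe' (a * b) = p.coe' a * p.coe' b :=
  UniformSpace.Completion.coe_mul (α := p.Pre) a b

theorem coe'_smul (c : ℂ) (a : F) : p.coe' (c • a) = c • p.coe' a :=
  UniformSpace.Completion.coe_smul (X := p.Pre) c a

theorem coe'_one : p.coe' 1 = 1 := rfl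

instance : StarRing p.Cpl where
  star_involutive x := by
    induction x using p.denseRange_coe'.induction_on with
    | hp => exact isClosed_eq (p.continuous_star_cpl.comp p.continuous_star_cpl) continuous_id
    | ih a => rw [star_coe', star_coe', star_star]
  star_mul x y := by
    induction x, y using p.denseRange_coe'.induction_on₂ with
    | hp =>
      exact isClosed_eq (p.continuous_star_cpl.comp continuous_mul)
        ((p.continuous_star_cpl.comp continuous_snd).mul (p.continuous_star_cpl.comp continuous_fst))
    | h a b => rw [← coe'_mul, star_coe', star_coe', star_coe', star_mul, coe'_mul]
  star_add x y := by
    induction x, y using p.denseRange_coe'.induction_on₂ with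
    | hp =>
      exact isClosed_eq (p.continuous_star_cpl.comp continuous_add)
        ((p.continuous_star_cpl.comp continuous_fst).add (p.continuous_star_cpl.comp continuous_snd))
    | h a b => rw [← coe'_add, star_coe', star_coe', star_coe', star_add, coe'_add]

instance : CStarRing p.Cpl where
  norm_mul_self_le x := by
    refine le_of_eq ?_
    induction x using p.denseRange_coe'.induction_on with
    | hp =>
      exact isClosed_eq (continuous_norm.mul continuous_norm)
        (continuous_norm.comp (p.continuous_star_cpl.mul continuous_id))
    | ih a => rw [star_coe', ← coe'_mul, norm_coe', norm_coe', p.star_mul_self', sq]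

instance [StarModule ℂ F] : StarModule ℂ p.Cpl where
  star_smul c x := by
    induction x using p.denseRange_coe'.induction_on with
    | hp =>
      exact isClosed_eq (p.continuous_star_cpl.comp (continuous_const_smul c))
        (p.continuous_star_cpl.const_smul (star c))
    | ih a => rw [← coe'_smul, star_coe', star_smul, star_coe', coe'_smul]

instance [StarModule ℂ F] : CStarAlgebra p.Cpl where

/-- The canonical *-homomorphism of `F` into its completion. -/
def of : F →⋆ₐ[ℂ] p.Cpl where
  toFun := p.coe'
  map_one' := rfl
  map_zero' := rfl
  map_mul' := p.coe'_mul
  map_add' := p.coe'_add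
  commutes' c := by
    rw [Algebra.algebraMap_eq_smul_one, coe'_smul, coe'_one, Algebra.algebraMap_eq_smul_one]
  map_star' a := (p.star_coe' a).symm

theorem norm_of (a : F) : ‖p.of a‖ = p a := p.norm_coe' a

theorem denseRange_of : DenseRange p.of := p.denseRange_coe'

/-- A *-homomorphism into a C*-algebra that is bounded by `p` extends to the completion. -/
theorem exists_extension {T : Type*} [CStarAlgebra T] (φ : F →⋆ₐ[ℂ] T) (h : ∀ a, ‖φ a‖ ≤ p a) :
    ∃ Φ : p.Cpl →⋆ₐ[ℂ] T, ∀ a, Φ (p.of a) = φ a := by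
  let φ' : p.Pre →+* T := (φ : F →ₐ[ℂ] T).toRingHom
  have hφ' : Continuous φ' :=
    AddMonoidHomClass.continuous_of_bound φ' 1 (fun a => by rw [one_mul]; exact h a)
  let Φ : p.Cpl →+* T := UniformSpace.Completion.extensionHom φ' hφ'
  have hc : Continuous Φ := UniformSpace.Completion.continuous_extension
  have hΦ (a : F) : Φ (p.coe' a) = φ a := UniformSpace.Completion.extensionHom_coe φ' hφ' a
  refine ⟨{ Φ with commutes' := fun c => ?_, map_star' := fun x => ?_ }, hΦ⟩
  · have : algebraMap ℂ p.Cpl c = p.coe' (algebraMap ℂ F c) := (p.of.commutes' c).symm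
    change Φ _ = _
    rw [this, hΦ, AlgHomClass.commutes]
  · change Φ (star x) = star (Φ x)
    induction x using p.denseRange_coe'.induction_on with
    | hp => exact isClosed_eq (hc.comp p.continuous_star_cpl) (continuous_star.comp hc)
    | ih a => rw [star_coe', hΦ, hΦ, map_star]
end pre
end CStarSeminorm

/-! ### C*-tensor products -/

section tensor

variable {A B : Type} [CStarAlgebra A] [CStarAlgebra B]

theorem CStarSeminorm.exists_bound_tensor (t : A ⊗[ℂ] B) :
    ∃ C : ℝ, ∀ p : CStarSeminorm (A ⊗[ℂ] B), p t ≤ C := by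
  induction t using TensorProduct.induction_on with
  | zero => exact ⟨0, fun p => p.zero_eq.le⟩
  | add s t hs ht =>
    obtain ⟨C, hC⟩ := hs
    obtain ⟨D, hD⟩ := ht
    exact ⟨C + D, fun p => (p.add_le s t).trans (add_le_add (hC p) (hD p))⟩
  | tmul a b =>
    refine ⟨‖a‖ * ‖b‖, fun p => ?_⟩
    let φ : A →⋆ₐ[ℂ] p.Cpl := p.of.comp
      { (Algebra.TensorProduct.includeLeft : A →ₐ[ℂ] A ⊗[ℂ] B) with
        map_star' := fun a => by simp }
    let ψ : B →⋆ₐ[ℂ] p.Cpl := p.of.comp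
      { (Algebra.TensorProduct.includeRight : B →ₐ[ℂ] A ⊗[ℂ] B) with
        map_star' := fun b => by simp }
    have hφ : ‖φ a‖ ≤ ‖a‖ := NonUnitalStarAlgHom.norm_apply_le φ a
    have hψ : ‖ψ b‖ ≤ ‖b‖ := NonUnitalStarAlgHom.norm_apply_le ψ b
    have : p.of (a ⊗ₜ[ℂ] b) = φ a * ψ b := by
      change _ = p.of (a ⊗ₜ[ℂ] 1) * p.of (1 ⊗ₜ[ℂ] b)
      rw [← map_mul, Algebra.TensorProduct.tmul_mul_tmul, one_mul, mul_one]
    rw [← p.norm_of, this]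
    exact (norm_mul_le _ _).trans (mul_le_mul hφ hψ (norm_nonneg _) (norm_nonneg _))

section hilbert

variable {H K : Type} [NormedAddCommGroup H] [InnerProductSpace ℂ H] [CompleteSpace H]
  [NormedAddCommGroup K] [InnerProductSpace ℂ K] [CompleteSpace K]

variable (H K) in
/-- The algebraic tensor product of two Hilbert spaces with the inner product determined by
`⟪x ⊗ y, x' ⊗ y'⟫ = ⟪x, x'⟫ ⟪y, y'⟫`. Its completion is the Hilbert space tensor product. -/
def HilbertTensor : Type := H ⊗[ℂ] K

instance : NormedAddCommGroup (HilbertTensor H K) := inferInstanceAs (NormedAddCommGroup (H ⊗[ℂ] K))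
instance : InnerProductSpace ℂ (HilbertTensor H K) :=
  inferInstanceAs (InnerProductSpace ℂ (H ⊗[ℂ] K))

/-- The bounded operator `x ⊗ y ↦ f x ⊗ g y`. -/
def HilbertTensor.map (f : H →L[ℂ] H) (g : K →L[ℂ] K) :
    HilbertTensor H K →L[ℂ] HilbertTensor H K := TensorProduct.mapL f g

/-- The tensor product `π ⊗ ρ` of two representations by bounded operators on Hilbert spaces,
acting on the (not completed) tensor product of the Hilbert spaces. The operator norm is not
affected by passing to the completion. -/
def tensorRep (π : A →⋆ₐ[ℂ] (H →L[ℂ] H)) (ρ : B →⋆ₐ[ℂ] (K →L[ℂ] K)) :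
    A ⊗[ℂ] B →ₐ[ℂ] (HilbertTensor H K →L[ℂ] HilbertTensor H K) :=
  Algebra.TensorProduct.lift
    (AlgHom.ofLinearMap
      { toFun := fun a => HilbertTensor.map (π a) 1
        map_add' := fun a b => by
          rw [map_add]; exact TensorProduct.mapL_add_left _ _ _
        map_smul' := fun c a => by
          rw [map_smul]; exact TensorProduct.mapL_smul_left _ _ _ }
      (by
        change HilbertTensor.map (π 1) 1 = 1
        rw [map_one]; exact TensorProduct.mapL_id_id)
      (fun a b => by
        change HilbertTensor.map (π (a * b)) 1 = _
        rw [map_mul, ← one_mul (1 : K →L[ℂ] K)]; exact TensorProduct.mapL_mul _ _ _ _))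
    (AlgHom.ofLinearMap
      { toFun := fun b => HilbertTensor.map 1 (ρ b)
        map_add' := fun a b => by
          rw [map_add]; exact TensorProduct.mapL_add_right _ _ _
        map_smul' := fun c a => by
          rw [map_smul]; exact TensorProduct.mapL_smul_right _ _ _ }
      (by
        change HilbertTensor.map 1 (ρ 1) = 1
        rw [map_one]; exact TensorProduct.mapL_id_id)
      (fun a b => by
        change HilbertTensor.map 1 (ρ (a * b)) = _
        rw [map_mul, ← one_mul (1 : H →L[ℂ] H)]; exact TensorProduct.mapL_mul _ _ _ _))
    (fun a b => by
      change HilbertTensor.map (π a) 1 * HilbertTensor.map 1 (ρ b) =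
        HilbertTensor.map 1 (ρ b) * HilbertTensor.map (π a) 1
      have h₁ : HilbertTensor.map (π a) 1 * HilbertTensor.map 1 (ρ b) =
        HilbertTensor.map (π a * 1) (1 * ρ b) := (TensorProduct.mapL_mul _ _ _ _).symm
      have h₂ : HilbertTensor.map 1 (ρ b) * HilbertTensor.map (π a) 1 =
        HilbertTensor.map (1 * π a) (ρ b * 1) := (TensorProduct.mapL_mul _ _ _ _).symm
      rw [h₁, h₂, one_mul, one_mul, mul_one, mul_one])

theorem tensorRep_tmul (π : A →⋆ₐ[ℂ] (H →L[ℂ] H)) (ρ : B →⋆ₐ[ℂ] (K →L[ℂ] K))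
    (a : A) (b : B) :
    tensorRep π ρ (a ⊗ₜ b) = HilbertTensor.map (π a) (ρ b) := by
  have h : HilbertTensor.map (π a) 1 * HilbertTensor.map 1 (ρ b) =
    HilbertTensor.map (π a * 1) (1 * ρ b) := (TensorProduct.mapL_mul _ _ _ _).symm
  rw [one_mul, mul_one] at h
  rw [← h]
  exact Algebra.TensorProduct.lift_tmul _ _ _ _ _

theorem inner_tensor_map (f : H →L[ℂ] H) (g : K →L[ℂ] K) (x y : H ⊗[ℂ] K) :
    inner ℂ (TensorProduct.map f.toLinearMap g.toLinearMap x) y =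
      inner ℂ x (TensorProduct.map (star f).toLinearMap (star g).toLinearMap y) := by
  induction x using TensorProduct.induction_on with
  | zero => simp
  | add s t hs ht => simp only [map_add, inner_add_left, hs, ht]
  | tmul x x' =>
    induction y using TensorProduct.induction_on with
    | zero => simp
    | add s t hs ht => simp only [map_add, inner_add_right, hs, ht]
    | tmul y y' =>
      rw [TensorProduct.map_tmul, TensorProduct.map_tmul, TensorProduct.inner_tmul,
        TensorProduct.inner_tmul, ContinuousLinearMap.star_eq_adjoint,
        ContinuousLinearMap.star_eq_adjoint]
      simp [ContinuousLinearMap.adjoint_inner_right]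

theorem HilbertTensor.inner_map (f : H →L[ℂ] H) (g : K →L[ℂ] K) (x y : HilbertTensor H K) :
    inner ℂ (HilbertTensor.map f g x) y = inner ℂ x (HilbertTensor.map (star f) (star g) y) := by
  have h₁ : HilbertTensor.map f g x =
      (TensorProduct.map f.toLinearMap g.toLinearMap x : H ⊗[ℂ] K) :=
    TensorProduct.mapL_apply f g x
  have h₂ : HilbertTensor.map (star f) (star g) y =
      (TensorProduct.map (star f).toLinearMap (star g).toLinearMap y : H ⊗[ℂ] K) :=
    TensorProduct.mapL_apply _ _ y
  rw [h₁, h₂]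
  exact inner_tensor_map f g x y

theorem inner_tensorRep (π : A →⋆ₐ[ℂ] (H →L[ℂ] H)) (ρ : B →⋆ₐ[ℂ] (K →L[ℂ] K))
    (t : A ⊗[ℂ] B) (x y : HilbertTensor H K) :
    inner ℂ (tensorRep π ρ t x) y = inner ℂ x (tensorRep π ρ (star t) y) := by
  induction t using TensorProduct.induction_on with
  | zero => simp
  | add s t hs ht =>
    simp only [map_add, star_add, add_apply, inner_add_left, inner_add_right, hs, ht]
  | tmul a b =>
    rw [TensorProduct.star_tmul, tensorRep_tmul, tensorRep_tmul, map_star, map_star,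
      HilbertTensor.inner_map]

/-- The C*-seminorm `t ↦ ‖(π ⊗ ρ)(t)‖` on the algebraic tensor product. -/
def repSeminorm (π : A →⋆ₐ[ℂ] (H →L[ℂ] H)) (ρ : B →⋆ₐ[ℂ] (K →L[ℂ] K)) :
    CStarSeminorm (A ⊗[ℂ] B) where
  toFun t := ‖tensorRep π ρ t‖
  map_zero' := by simp
  add_le' s t := by rw [map_add]; exact norm_add_le _ _
  neg' t := by simp
  smul' c t := by rw [map_smul, norm_smul]
  mul_le' s t := by rw [map_mul]; exact norm_mul_le _ _
  star_mul_self' t := by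
    have key (s : A ⊗[ℂ] B) :
        ‖tensorRep π ρ s‖ * ‖tensorRep π ρ s‖ ≤ ‖tensorRep π ρ (star s * s)‖ := by
      refine (Real.le_sqrt (norm_nonneg _) (norm_nonneg _)).1 ?_ |>.trans' (by rw [sq])
      refine ContinuousLinearMap.opNorm_le_bound _ (Real.sqrt_nonneg _) fun x => ?_
      refine le_of_sq_le_sq ?_ (by positivity)
      rw [mul_pow, Real.sq_sqrt (norm_nonneg _), ← inner_self_eq_norm_sq (𝕜 := ℂ), inner_tensorRep,
        ← mul_apply_eq_comp, ← map_mul]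
      calc RCLike.re (inner ℂ x (tensorRep π ρ (star s * s) x))
          ≤ ‖inner ℂ x (tensorRep π ρ (star s * s) x)‖ := RCLike.re_le_norm _
        _ ≤ ‖x‖ * ‖tensorRep π ρ (star s * s) x‖ := norm_inner_le_norm _ _
        _ ≤ ‖x‖ * (‖tensorRep π ρ (star s * s)‖ * ‖x‖) := by
          gcongr; exact ContinuousLinearMap.le_opNorm _ _
        _ = _ := by ring
    have le_star (s : A ⊗[ℂ] B) : ‖tensorRep π ρ s‖ ≤ ‖tensorRep π ρ (star s)‖ := by
      rcases (norm_nonneg (tensorRep π ρ s)).eq_or_lt with h0 | h0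
      · rw [← h0]; exact norm_nonneg _
      · refine le_of_mul_le_mul_right ((key s).trans ?_) h0
        rw [map_mul]; exact norm_mul_le _ _
    refine le_antisymm ?_ (by rw [sq]; exact key t)
    rw [map_mul, sq]
    refine (norm_mul_le _ _).trans ?_
    gcongr
    simpa using le_star (star t)

end hilbert

variable (A B)

/-- The minimal (spatial) C*-norm: the supremum of `‖(π ⊗ ρ)(t)‖` over all representations `π` of
`A` and `ρ` of `B` on Hilbert spaces. -/
def minSeminorm : CStarSeminorm (A ⊗[ℂ] B) :=
  CStarSeminorm.supOf
    {p | ∃ (H K : Type) (_ : NormedAddCommGroup H) (_ : InnerProductSpace ℂ H)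
      (_ : CompleteSpace H) (_ : NormedAddCommGroup K) (_ : InnerProductSpace ℂ K)
      (_ : CompleteSpace K) (π : A →⋆ₐ[ℂ] (H →L[ℂ] H)) (ρ : B →⋆ₐ[ℂ] (K →L[ℂ] K)),
      p = repSeminorm π ρ}
    fun t => (CStarSeminorm.exists_bound_tensor t).imp fun _ h p _ => h p

/-- The maximal C*-norm: the supremum of all C*-seminorms on the algebraic tensor product. -/
def maxSeminorm : CStarSeminorm (A ⊗[ℂ] B) :=
  CStarSeminorm.supOf Set.univ
    fun t => (CStarSeminorm.exists_bound_tensor t).imp fun _ h p _ => h p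

/-- The two standard conventions for the tensor product of C*-algebras. -/
inductive TensorKind
  | minimal
  | maximal

/-- The C*-norm of the chosen C*-tensor product. -/
def TensorKind.seminorm : TensorKind → CStarSeminorm (A ⊗[ℂ] B)
  | .minimal => minSeminorm A B
  | .maximal => maxSeminorm A B

/-- The tensor product of two (unital) C*-algebras: the completion of the algebraic tensor product with
respect to the chosen C*-norm. -/
abbrev TensorKind.tensor (τ : TensorKind) : Type := (τ.seminorm A B).Cpl

variable {A B}

/-- The elementary tensor `a ⊗ b` in the C*-tensor product. -/
def TensorKind.tmul (τ : TensorKind) (a : A) (b : B) : τ.tensor A B :=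
  (τ.seminorm A B).of (a ⊗ₜ[ℂ] b)

end tensor

/-! ### Noncommutative polynomials and universal C*-algebras -/

/-- Noncommutative polynomials in the variables `X i`, which are self-adjoint for the *-operation
defined below. -/
abbrev NCPoly (I : Type) : Type := MonoidAlgebra ℂ (FreeMonoid I)

namespace NCPoly

variable {I : Type}

/-- The variables. -/
def X (i : I) : NCPoly I := MonoidAlgebra.of ℂ (FreeMonoid I) (FreeMonoid.of i)

/-- The *-operation reverses words and conjugates coefficients. -/
def starAux : NCPoly I →+ NCPoly I :=
  MonoidAlgebra.liftNC ((algebraMap ℂ (NCPoly I)).comp (starRingEnd ℂ)).toAddMonoidHom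
    (fun w => MonoidAlgebra.of ℂ (FreeMonoid I) (star w))

theorem starAux_single (w : FreeMonoid I) (c : ℂ) :
    starAux (MonoidAlgebra.single w c) = MonoidAlgebra.single (star w) (starRingEnd ℂ c) := by
  rw [starAux, MonoidAlgebra.liftNC_single]
  simp

instance : StarRing (NCPoly I) where
  star := starAux
  star_involutive f := by
    induction f using MonoidAlgebra.induction_linear with
    | zero => simp
    | add f g hf hg => simp only [map_add, hf, hg]
    | single w c => simp [starAux_single]
  star_mul f g := by
    induction f using MonoidAlgebra.induction_linear with
    | zero => simp
    | add f f' hf hf' => rw [add_mul, map_add, hf, hf', map_add, mul_add]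
    | single w c =>
      induction g using MonoidAlgebra.induction_linear with
      | zero => simp
      | add f f' hf hf' => rw [mul_add, map_add, hf, hf', map_add, add_mul]
      | single v d =>
        rw [MonoidAlgebra.single_mul_single, starAux_single, starAux_single, starAux_single,
          MonoidAlgebra.single_mul_single, star_mul, map_mul, mul_comm (starRingEnd ℂ c)]
  star_add f g := map_add _ _ _

theorem star_single (w : FreeMonoid I) (c : ℂ) :
    star (MonoidAlgebra.single w c : NCPoly I) = MonoidAlgebra.single (star w) (starRingEnd ℂ c) :=
  starAux_single w c

@[simp] theorem star_X (i : I) : star (X i) = X i := by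
  rw [X, MonoidAlgebra.of_apply, star_single]; simp

instance : StarModule ℂ (NCPoly I) where
  star_smul c f := by
    induction f using MonoidAlgebra.induction_linear with
    | zero => simp
    | add f g hf hg => rw [smul_add, star_add, hf, hg, star_add, smul_add]
    | single w d => rw [MonoidAlgebra.smul_single, star_single, star_single]; simp

/-- Evaluation of noncommutative polynomials at self-adjoint elements. -/
def eval {T : Type*} [Ring T] [StarRing T] [Algebra ℂ T] [StarModule ℂ T] (y : I → T)
    (hy : ∀ i, star (y i) = y i) : NCPoly I →⋆ₐ[ℂ] T :=
  { MonoidAlgebra.lift ℂ T (FreeMonoid I) (FreeMonoid.lift y) with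
    map_star' := fun f => by
      have hw (w : FreeMonoid I) : FreeMonoid.lift y (star w) = star (FreeMonoid.lift y w) := by
        induction w using FreeMonoid.inductionOn' with
        | one => simp
        | of_mul i w ih => rw [star_mul, map_mul, map_mul, star_mul, ih]; simp [hy]
      change MonoidAlgebra.lift ℂ T (FreeMonoid I) (FreeMonoid.lift y) (star f) =
        star (MonoidAlgebra.lift ℂ T (FreeMonoid I) (FreeMonoid.lift y) f)
      induction f using MonoidAlgebra.induction_linear with
      | zero => simp
      | add f g hf hg => rw [star_add, map_add, map_add, star_add, hf, hg]
      | single w c =>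
        rw [star_single, MonoidAlgebra.lift_single, MonoidAlgebra.lift_single, hw, star_smul]
        rfl }

@[simp] theorem eval_X {T : Type*} [Ring T] [StarRing T] [Algebra ℂ T] [StarModule ℂ T]
    (y : I → T) (hy : ∀ i, star (y i) = y i) (i : I) : eval y hy (X i) = y i := by
  change MonoidAlgebra.lift ℂ T (FreeMonoid I) (FreeMonoid.lift y) (X i) = y i
  simp [X]

theorem adjoin_X : StarAlgebra.adjoin ℂ (Set.range (X : I → NCPoly I)) = ⊤ := by
  rw [eq_top_iff]
  rintro f -
  induction f using MonoidAlgebra.induction_linear with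
  | zero => exact zero_mem _
  | add f g hf hg => exact add_mem hf hg
  | single w c =>
    have : (MonoidAlgebra.single w c : NCPoly I) = c • MonoidAlgebra.of ℂ (FreeMonoid I) w := by
      simp
    rw [this]
    refine SMulMemClass.smul_mem c ?_
    induction w using FreeMonoid.inductionOn' with
    | one => rw [map_one]; exact one_mem _
    | of_mul i w ih =>
      rw [map_mul]
      refine mul_mem (StarAlgebra.subset_adjoin ℂ _ ⟨i, rfl⟩) (ih ?_)
      simp

end NCPoly

open NCPoly

section universal

variable {I : Type}

/-- The set of relations `P = 0`, `P ∈ R`, between self-adjoint variables bounds all the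
C*-seminorms, so that the corresponding universal C*-algebra exists. -/
def IsBoundedRel (R : Set (NCPoly I)) : Prop :=
  ∀ f : NCPoly I, ∃ C : ℝ, ∀ p ∈ {p : CStarSeminorm (NCPoly I) | ∀ P ∈ R, p P = 0}, p f ≤ C

/-- The universal C*-algebra generated by self-adjoint variables `X i` with the relations `P = 0`,
`P ∈ R`: the completion with respect to the largest C*-seminorm vanishing on `R`. -/
abbrev UniversalCStar (R : Set (NCPoly I)) (hR : IsBoundedRel R) : Type :=
  (CStarSeminorm.supOf {p : CStarSeminorm (NCPoly I) | ∀ P ∈ R, p P = 0} hR).Cpl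

/-- The standard generators of the universal C*-algebra. -/
def UniversalCStar.gen (R : Set (NCPoly I)) (hR : IsBoundedRel R) (i : I) : UniversalCStar R hR :=
  (CStarSeminorm.supOf _ hR).of (X i)

variable {R : Set (NCPoly I)} {hR : IsBoundedRel R}

theorem UniversalCStar.star_gen (i : I) : star (gen R hR i) = gen R hR i := by
  rw [gen, ← map_star, star_X]

theorem NCPoly.eval_gen (f : NCPoly I) :
    eval (UniversalCStar.gen R hR) UniversalCStar.star_gen f = (CStarSeminorm.supOf _ hR).of f := by
  have hf : f ∈ StarAlgebra.adjoin ℂ (Set.range (X : I → NCPoly I)) := by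
    rw [adjoin_X]; trivial
  have hle : StarAlgebra.adjoin ℂ (Set.range (X : I → NCPoly I)) ≤
      StarAlgHom.equalizer (eval (UniversalCStar.gen R hR) UniversalCStar.star_gen)
        (CStarSeminorm.supOf _ hR).of := by
    rw [StarAlgebra.adjoin_le_iff]
    rintro _ ⟨i, rfl⟩
    exact eval_X _ UniversalCStar.star_gen i
  exact hle hf

theorem UniversalCStar.relation {P : NCPoly I} (hP : P ∈ R) :
    eval (gen R hR) star_gen P = 0 := by
  rw [eval_gen, ← norm_eq_zero, CStarSeminorm.norm_of]
  refine le_antisymm ?_ (CStarSeminorm.nonneg _ _)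
  exact Real.iSup_le (fun p => (p.2 P hP).le) le_rfl

/-- The universal property. -/
theorem UniversalCStar.exists_lift {T : Type*} [CStarAlgebra T] (y : I → T)
    (hy : ∀ i, star (y i) = y i) (h : ∀ P ∈ R, eval y hy P = 0) :
    ∃ Φ : UniversalCStar R hR →⋆ₐ[ℂ] T, ∀ i, Φ (gen R hR i) = y i := by
  obtain ⟨Φ, hΦ⟩ := CStarSeminorm.exists_extension (CStarSeminorm.supOf _ hR) (eval y hy)
    (fun f => CStarSeminorm.le_supOf (p := CStarSeminorm.ofHom (eval y hy))
      (fun P hP => by simp [h P hP]) f)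
  exact ⟨Φ, fun i => (hΦ _).trans (eval_X y hy i)⟩

theorem UniversalCStar.generates :
    (StarAlgebra.adjoin ℂ (Set.range (gen R hR))).topologicalClosure = ⊤ := by
  have h1 : StarAlgebra.adjoin ℂ (Set.range (gen R hR)) =
      (⊤ : StarSubalgebra ℂ (NCPoly I)).map (CStarSeminorm.supOf _ hR).of := by
    rw [← adjoin_X, StarAlgHom.map_adjoin, ← Set.range_comp]; rfl
  rw [h1, eq_top_iff]
  intro x _
  change x ∈ closure _
  have := (CStarSeminorm.supOf _ hR).denseRange_of x
  refine closure_mono ?_ this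
  rintro _ ⟨f, rfl⟩
  exact ⟨f, trivial, rfl⟩

theorem isBoundedRel_of_sq (R : Set (NCPoly I))
    (h : ∀ i : I, ∃ s : Finset I, i ∈ s ∧ ∑ j ∈ s, X j * X j - 1 ∈ R) : IsBoundedRel R := by
  have hX (i : I) (p : CStarSeminorm (NCPoly I)) (hp : ∀ P ∈ R, p P = 0) : p (X i) ≤ 1 := by
    obtain ⟨s, hi, hs⟩ := h i
    let := CStarAlgebra.spectralOrder p.Cpl
    let := CStarAlgebra.spectralOrderedRing p.Cpl
    have h1 : ∑ j ∈ s, p.of (X j) * p.of (X j) = 1 := by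
      have := hp _ hs
      rw [← p.norm_of, norm_eq_zero, map_sub, map_sum, map_one, sub_eq_zero] at this
      simpa using this
    have hsa (j : I) : star (p.of (X j)) = p.of (X j) := by rw [← map_star, star_X]
    have hpos (j : I) : 0 ≤ p.of (X j) * p.of (X j) := by
      have := star_mul_self_nonneg (p.of (X j)); rwa [hsa] at this
    have h2 : p.of (X i) * p.of (X i) ≤ 1 := by
      rw [← h1]
      exact Finset.single_le_sum (f := fun j => p.of (X j) * p.of (X j)) (fun j _ => hpos j) hi
    have h3 : ‖p.of (X i) * p.of (X i)‖ ≤ 1 :=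
      (CStarAlgebra.norm_le_one_iff_of_nonneg _ (hpos i)).2 h2
    have h4 : ‖p.of (X i)‖ * ‖p.of (X i)‖ ≤ 1 := by
      rw [← CStarRing.norm_star_mul_self, hsa]; exact h3
    rw [← p.norm_of]
    nlinarith [norm_nonneg (p.of (X i))]
  have h1 : ∃ C : ℝ, ∀ p : CStarSeminorm (NCPoly I), p 1 ≤ C := by
    refine ⟨1, fun p => ?_⟩
    have := p.star_mul_self' 1
    rw [star_one, one_mul] at this
    nlinarith [p.nonneg 1]
  intro f
  induction f using MonoidAlgebra.induction_linear with
  | zero => exact ⟨0, fun p _ => p.zero_eq.le⟩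
  | add f g hf hg =>
    obtain ⟨C, hC⟩ := hf
    obtain ⟨D, hD⟩ := hg
    exact ⟨C + D, fun p hp => (p.add_le f g).trans (add_le_add (hC p hp) (hD p hp))⟩
  | single w c =>
    have hw : ∀ p ∈ {p : CStarSeminorm (NCPoly I) | ∀ P ∈ R, p P = 0},
        p (MonoidAlgebra.of ℂ (FreeMonoid I) w) ≤ 1 := by
      intro p hp
      induction w using FreeMonoid.inductionOn' with
      | one =>
        rw [map_one]
        have := p.star_mul_self' 1
        rw [star_one, one_mul] at this
        nlinarith [p.nonneg 1]
      | of_mul i w ih =>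
        rw [map_mul]
        refine (p.mul_le' _ _).trans ?_
        exact mul_le_one₀ (hX i p hp) (p.nonneg _) ih
    refine ⟨‖c‖, fun p hp => ?_⟩
    have : (MonoidAlgebra.single w c : NCPoly I) = c • MonoidAlgebra.of ℂ (FreeMonoid I) w := by
      simp
    rw [this, p.smul_eq]
    exact mul_le_of_le_one_right (norm_nonneg c) (hw p hp)

end universal

/-! ### Closed subspaces of the free real sphere -/

/-- A closed noncommutative subspace `X` of the free real sphere: a quotient of the universal
C*-algebra generated by self-adjoint `x 1, …, x N` with `∑ x i ^ 2 = 1`, given as the C*-algebra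
`C(X)` together with the standard coordinates. -/
structure SphereSubspace (N : ℕ) where
  alg : Type
  [cstar : CStarAlgebra alg]
  x : Fin N → alg
  star_x : ∀ i, star (x i) = x i
  sum_sq : ∑ i, x i * x i = 1
  generates : (StarAlgebra.adjoin ℂ (Set.range x)).topologicalClosure = ⊤

attribute [instance] SphereSubspace.cstar

section relations

variable (N d : ℕ)

/-- `∑ x i ^ 2 = 1`. -/
def sphereRel : Set (NCPoly (Fin N)) := {∑ i, X i * X i - 1}

/-- `x i₀ ⋯ x i_d = 0` for `i₀, …, i_d` distinct. -/
def polygonalRel : Set (NCPoly (Fin N)) :=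
  {P | ∃ i : Fin (d + 1) → Fin N, Function.Injective i ∧ P = (List.ofFn fun k => X (i k)).prod}

/-- `x i x j = - x j x i` for `i ≠ j`. -/
def anticommRel : Set (NCPoly (Fin N)) :=
  {P | ∃ i j, i ≠ j ∧ P = X i * X j + X j * X i}

/-- `a b c = c b a` for all variables `a, b, c`. -/
def halfCommRel (I : Type) : Set (NCPoly I) :=
  {P | ∃ a b c : I, P = X a * X b * X c - X c * X b * X a}

/-- `x i x j x k = - x k x j x i` for `i, j, k` distinct, `x i x j x k = x k x j x i` otherwise. -/
def twistedHalfCommRel : Set (NCPoly (Fin N)) :=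
  {P | ∃ i j k, (i ≠ j ∧ j ≠ k ∧ i ≠ k) ∧ P = X i * X j * X k + X k * X j * X i} ∪
  {P | ∃ i j k, ¬(i ≠ j ∧ j ≠ k ∧ i ≠ k) ∧ P = X i * X j * X k - X k * X j * X i}

end relations

theorem isBoundedRel_sphere {N : ℕ} (R : Set (NCPoly (Fin N))) :
    IsBoundedRel (sphereRel N ∪ R) :=
  isBoundedRel_of_sq _ fun i => ⟨Finset.univ, Finset.mem_univ i, Or.inl rfl⟩

/-- The subspace of the free real sphere obtained by imposing the relations `P = 0`, `P ∈ R`. -/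
def SphereSubspace.ofRel {N : ℕ} (R : Set (NCPoly (Fin N))) : SphereSubspace N where
  alg := UniversalCStar (sphereRel N ∪ R) (isBoundedRel_sphere R)
  x := UniversalCStar.gen _ _
  star_x := UniversalCStar.star_gen
  sum_sq := by
    have := UniversalCStar.relation (hR := isBoundedRel_sphere R)
      (P := ∑ i, X i * X i - 1) (Or.inl rfl)
    simpa [sub_eq_zero] using this
  generates := UniversalCStar.generates

/-- The polygonal sphere: points of the unit sphere of `ℝ^N` such that `x i₀ ⋯ x i_d = 0` for
`i₀, …, i_d` distinct. -/
def polygonalSphereSet (N d : ℕ) : Set (EuclideanSpace ℝ (Fin N)) :=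
  {x | ‖x‖ = 1 ∧ ∀ i : Fin (d + 1) → Fin N, Function.Injective i → ∏ k, x (i k) = 0}

instance (N d : ℕ) : CompactSpace (polygonalSphereSet N d) := by
  rw [← isCompact_iff_compactSpace]
  have hc : IsClosed (polygonalSphereSet N d) := by
    have h : polygonalSphereSet N d = {x | ‖x‖ = 1} ∩
        ⋂ i : Fin (d + 1) → Fin N, ⋂ _ : Function.Injective i,
          {x : EuclideanSpace ℝ (Fin N) | ∏ k, x (i k) = 0} := by
      ext x; simp [polygonalSphereSet]
    rw [h]
    refine (isClosed_eq continuous_norm continuous_const).inter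
      (isClosed_iInter fun i => isClosed_iInter fun _ => isClosed_eq ?_ continuous_const)
    fun_prop
  refine (isCompact_sphere (0 : EuclideanSpace ℝ (Fin N)) 1).of_isClosed_subset hc fun x hx => ?_
  simpa using hx.1

/-- The real polygonal sphere, with its algebra of continuous functions. -/
def polygonalSphere (N d : ℕ) : SphereSubspace N where
  alg := C(polygonalSphereSet N d, ℂ)
  x i := ⟨fun p => ((p.1 i : ℝ) : ℂ), by fun_prop⟩
  star_x i := by ext p; simp
  sum_sq := by
    ext p
    have h := p.2.1
    have h2 : ∑ i, p.1 i * p.1 i = 1 := by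
      have := EuclideanSpace.norm_sq_eq p.1
      rw [h] at this
      simpa [sq] using this.symm
    simp only [ContinuousMap.coe_sum, ContinuousMap.coe_mul, Finset.sum_apply, Pi.mul_apply,
      ContinuousMap.coe_mk, ContinuousMap.one_apply]
    exact_mod_cast h2
  generates := by
    apply ContinuousMap.starSubalgebra_topologicalClosure_eq_top_of_separatesPoints
    intro p q hpq
    obtain ⟨i, hi⟩ : ∃ i, p.1 i ≠ q.1 i := by
      by_contra! h
      exact hpq (Subtype.ext (PiLp.ext h))
    refine ⟨_, ⟨⟨fun p => ((p.1 i : ℝ) : ℂ), by fun_prop⟩,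
      StarAlgebra.subset_adjoin ℂ _ ⟨i, rfl⟩, rfl⟩, ?_⟩
    simpa using hi

/-- The twisted polygonal sphere. -/
def twistedPolygonalSphere (N d : ℕ) : SphereSubspace N :=
  .ofRel (anticommRel N ∪ polygonalRel N d)

/-- The half-liberated polygonal sphere. -/
def halfPolygonalSphere (N d : ℕ) : SphereSubspace N :=
  .ofRel (halfCommRel (Fin N) ∪ polygonalRel N d)

/-- The twisted half-liberated polygonal sphere. -/
def twistedHalfPolygonalSphere (N d : ℕ) : SphereSubspace N :=
  .ofRel (twistedHalfCommRel N ∪ polygonalRel N d)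

/-- The free polygonal sphere. -/
def freePolygonalSphere (N d : ℕ) : SphereSubspace N :=
  .ofRel (polygonalRel N d)

/-! ### Closed quantum subgroups of the free orthogonal quantum group -/

/-- A closed quantum subgroup `G` of the free orthogonal quantum group: a C*-algebra `C(G)`
generated by the self-adjoint entries of an orthogonal matrix `u`, such that
`u i j ↦ ∑ k, u i k ⊗ u k j` defines a comultiplication. -/
structure QuantumSubgroup (τ : TensorKind) (N : ℕ) where
  alg : Type
  [cstar : CStarAlgebra alg]
  u : Fin N → Fin N → alg
  star_u : ∀ i j, star (u i j) = u i j
  row_orth : ∀ i j, ∑ k, u i k * u j k = if i = j then 1 else 0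
  col_orth : ∀ i j, ∑ k, u k i * u k j = if i = j then 1 else 0
  generates : (StarAlgebra.adjoin ℂ
    (Set.range fun a : Fin N × Fin N => u a.1 a.2)).topologicalClosure = ⊤
  exists_comul : ∃ Δ : alg →⋆ₐ[ℂ] τ.tensor alg alg,
    ∀ i j, Δ (u i j) = ∑ k, τ.tmul (u i k) (u k j)

attribute [instance] QuantumSubgroup.cstar

section relations

variable (N : ℕ)

/-- The matrix of variables is orthogonal. -/
def orthogonalRel : Set (NCPoly (Fin N × Fin N)) :=
  {P | ∃ i j, P = ∑ k, X (i, k) * X (j, k) - if i = j then 1 else 0} ∪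
  {P | ∃ i j, P = ∑ k, X (k, i) * X (k, j) - if i = j then 1 else 0}

/-- Two distinct matrix positions on the same row or on the same column. -/
def SameLine {N : ℕ} (a b : Fin N × Fin N) : Prop := a ≠ b ∧ (a.1 = b.1 ∨ a.2 = b.2)

/-- `a b = 0` whenever `a ≠ b` are on the same row or column. -/
def cubicRel : Set (NCPoly (Fin N × Fin N)) :=
  {P | ∃ a b, SameLine a b ∧ P = X a * X b}

/-- `a b c = 0` whenever `a ≠ c` are on the same row or column. -/
def higherCubicRel : Set (NCPoly (Fin N × Fin N)) :=
  {P | ∃ a b c, SameLine a c ∧ P = X a * X b * X c}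

end relations

theorem isBoundedRel_orthogonal {N : ℕ} (R : Set (NCPoly (Fin N × Fin N))) :
    IsBoundedRel (orthogonalRel N ∪ R) := by
  refine isBoundedRel_of_sq _ fun a =>
    ⟨Finset.univ.map ⟨fun k => (a.1, k), fun k l h => by simpa using h⟩, ?_, ?_⟩
  · exact Finset.mem_map.2 ⟨a.2, Finset.mem_univ _, rfl⟩
  · refine Or.inl (Or.inl ⟨a.1, a.1, ?_⟩)
    rw [Finset.sum_map, if_pos rfl]; rfl

/-- The relations `R` between the entries of an orthogonal matrix are stable under products of
matrices with commuting entries. -/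
def IsMultiplicativeRel {N : ℕ} (R : Set (NCPoly (Fin N × Fin N))) : Prop :=
  ∀ (T : Type) [CStarAlgebra T] (v w y : Fin N × Fin N → T) (hv : ∀ a, star (v a) = v a)
    (hw : ∀ a, star (w a) = w a) (hy : ∀ a, star (y a) = y a),
    (∀ a b, v a * w b = w b * v a) → (∀ i j, y (i, j) = ∑ k, v (i, k) * w (k, j)) →
    (∀ P ∈ orthogonalRel N ∪ R, eval v hv P = 0) → (∀ P ∈ orthogonalRel N ∪ R, eval w hw P = 0) →
    ∀ P ∈ R, eval y hy P = 0

section tmul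

variable {A B : Type} [CStarAlgebra A] [CStarAlgebra B] (τ : TensorKind)

theorem TensorKind.tmul_mul (a a' : A) (b b' : B) :
    τ.tmul a b * τ.tmul a' b' = τ.tmul (a * a') (b * b') := by
  rw [tmul, tmul, tmul, ← map_mul, Algebra.TensorProduct.tmul_mul_tmul]

theorem TensorKind.star_tmul (a : A) (b : B) : star (τ.tmul a b) = τ.tmul (star a) (star b) := by
  rw [tmul, tmul, ← map_star, TensorProduct.star_tmul]

/-- `a ↦ a ⊗ 1`. -/
def TensorKind.inl : A →⋆ₐ[ℂ] τ.tensor A B :=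
  (τ.seminorm A B).of.comp
    { (Algebra.TensorProduct.includeLeft : A →ₐ[ℂ] A ⊗[ℂ] B) with
      map_star' := fun a => by simp }

/-- `b ↦ 1 ⊗ b`. -/
def TensorKind.inr : B →⋆ₐ[ℂ] τ.tensor A B :=
  (τ.seminorm A B).of.comp
    { (Algebra.TensorProduct.includeRight : B →ₐ[ℂ] A ⊗[ℂ] B) with
      map_star' := fun a => by simp }

theorem TensorKind.inl_apply (a : A) : τ.inl (B := B) a = τ.tmul a 1 := rfl
theorem TensorKind.inr_apply (b : B) : τ.inr (A := A) b = τ.tmul 1 b := rfl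

theorem TensorKind.inl_mul_inr (a : A) (b : B) : τ.inl a * τ.inr b = τ.tmul a b := by
  rw [inl_apply, inr_apply, tmul_mul, one_mul, mul_one]

theorem TensorKind.inr_mul_inl (a : A) (b : B) : τ.inr b * τ.inl a = τ.tmul a b := by
  rw [inl_apply, inr_apply, tmul_mul, one_mul, mul_one]

end tmul

theorem NCPoly.eval_comp {I : Type} {S T : Type*} [CStarAlgebra S] [CStarAlgebra T]
    (φ : S →⋆ₐ[ℂ] T) (y : I → S) (hy : ∀ i, star (y i) = y i)
    (hy' : ∀ i, star (φ (y i)) = φ (y i)) (P : NCPoly I) :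
    eval (fun i => φ (y i)) hy' P = φ (eval y hy P) := by
  have hf : P ∈ StarAlgebra.adjoin ℂ (Set.range (X : I → NCPoly I)) := by
    rw [adjoin_X]; trivial
  have hle : StarAlgebra.adjoin ℂ (Set.range (X : I → NCPoly I)) ≤
      StarAlgHom.equalizer (eval (fun i => φ (y i)) hy') (φ.comp (eval y hy)) := by
    rw [StarAlgebra.adjoin_le_iff]
    rintro _ ⟨i, rfl⟩
    change _ = φ (eval y hy (X i))
    rw [eval_X]
    exact eval_X _ hy' i
  exact hle hf

section stable

variable {N : ℕ}

theorem SameLine.split {i p j q : Fin N} (h : SameLine (i, p) (j, q)) (k l : Fin N) :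
    SameLine (i, k) (j, l) ∨ SameLine (k, p) (l, q) := by
  obtain ⟨h1, h2⟩ := h
  simp only [SameLine, ne_eq, Prod.mk.injEq, not_and] at *
  grind

theorem mul_expand {T : Type} [Ring T] {v w y : Fin N × Fin N → T}
    (hc : ∀ a b, v a * w b = w b * v a) (hy : ∀ i j, y (i, j) = ∑ k, v (i, k) * w (k, j))
    (i p j q : Fin N) :
    y (i, p) * y (j, q) =
      ∑ k, ∑ l, (v (i, k) * v (j, l)) * (w (k, p) * w (l, q)) := by
  rw [hy, hy, Finset.sum_mul_sum]
  refine Finset.sum_congr rfl fun k _ => Finset.sum_congr rfl fun l _ => ?_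
  rw [mul_assoc, ← mul_assoc (w (k, p)), ← hc, mul_assoc, ← mul_assoc, mul_assoc]

theorem mul_expand₃ {T : Type} [Ring T] {v w y : Fin N × Fin N → T}
    (hc : ∀ a b, v a * w b = w b * v a) (hy : ∀ i j, y (i, j) = ∑ k, v (i, k) * w (k, j))
    (i p m s j q : Fin N) :
    y (i, p) * y (m, s) * y (j, q) =
      ∑ k, ∑ r, ∑ l, (v (i, k) * v (m, r) * v (j, l)) * (w (k, p) * w (r, s) * w (l, q)) := by
  rw [mul_expand hc hy, hy, Finset.sum_mul]
  refine Finset.sum_congr rfl fun k _ => ?_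
  rw [Finset.sum_mul_sum]
  refine Finset.sum_congr rfl fun r _ => Finset.sum_congr rfl fun l _ => ?_
  have h : w (k, p) * w (r, s) * v (j, l) = v (j, l) * (w (k, p) * w (r, s)) := by
    rw [mul_assoc, ← hc, ← mul_assoc, ← hc, mul_assoc]
  rw [mul_assoc, ← mul_assoc (w (k, p) * w (r, s)), h, mul_assoc (v (j, l)), ← mul_assoc]

theorem cubic_mul {T : Type} [Ring T] {v w y : Fin N × Fin N → T}
    (hc : ∀ a b, v a * w b = w b * v a) (hy : ∀ i j, y (i, j) = ∑ k, v (i, k) * w (k, j))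
    (hv : ∀ a b, SameLine a b → v a * v b = 0) (hw : ∀ a b, SameLine a b → w a * w b = 0)
    (a b : Fin N × Fin N) (hab : SameLine a b) : y a * y b = 0 := by
  obtain ⟨i, p⟩ := a
  obtain ⟨j, q⟩ := b
  rw [mul_expand hc hy]
  refine Finset.sum_eq_zero fun k _ => Finset.sum_eq_zero fun l _ => ?_
  rcases hab.split k l with h | h
  · rw [hv _ _ h, zero_mul]
  · rw [hw _ _ h, mul_zero]

theorem isMultiplicativeRel_higherCubic : IsMultiplicativeRel (higherCubicRel N) := by
  rintro T _ v w y hv hw hy hc hyvw h1 h2 _ ⟨⟨i, p⟩, ⟨m, s⟩, ⟨j, q⟩, hab, rfl⟩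
  have h1' (a b c) (h : SameLine a c) : v a * v b * v c = 0 := by
    simpa using h1 _ (Or.inr ⟨a, b, c, h, rfl⟩)
  have h2' (a b c) (h : SameLine a c) : w a * w b * w c = 0 := by
    simpa using h2 _ (Or.inr ⟨a, b, c, h, rfl⟩)
  rw [map_mul, map_mul, eval_X, eval_X, eval_X, mul_expand₃ hc hyvw]
  refine Finset.sum_eq_zero fun k _ => Finset.sum_eq_zero fun r _ =>
    Finset.sum_eq_zero fun l _ => ?_
  rcases hab.split k l with h | h
  · rw [h1' _ _ _ h, zero_mul]
  · rw [h2' _ _ _ h, mul_zero]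

theorem isMultiplicativeRel_half_cubic :
    IsMultiplicativeRel (halfCommRel (Fin N × Fin N) ∪ cubicRel N) := by
  rintro T _ v w y hv hw hy hc hyvw h1 h2 _ (⟨⟨i, p⟩, ⟨m, s⟩, ⟨j, q⟩, rfl⟩ | ⟨a, b, hab, rfl⟩)
  · have h1' (a b c) : v a * v b * v c = v c * v b * v a := by
      simpa [sub_eq_zero] using h1 _ (Or.inr (Or.inl ⟨a, b, c, rfl⟩))
    have h2' (a b c) : w a * w b * w c = w c * w b * w a := by
      simpa [sub_eq_zero] using h2 _ (Or.inr (Or.inl ⟨a, b, c, rfl⟩))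
    simp only [map_sub, map_mul, eval_X]
    rw [mul_expand₃ hc hyvw, mul_expand₃ hc hyvw, sub_eq_zero]
    simp_rw [h1' (i, _), h2' (_, p)]
    rw [Finset.sum_comm]
    refine (Finset.sum_congr rfl fun r _ => Finset.sum_comm).trans ?_
    rw [Finset.sum_comm]
  · rw [map_mul, eval_X, eval_X]
    exact cubic_mul hc hyvw
      (fun a b h => by simpa using h1 _ (Or.inr (Or.inr ⟨a, b, h, rfl⟩)))
      (fun a b h => by simpa using h2 _ (Or.inr (Or.inr ⟨a, b, h, rfl⟩))) a b hab

theorem orthogonal_mul {T : Type} [CStarAlgebra T] {v w y : Fin N × Fin N → T}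
    (hv : ∀ a, star (v a) = v a) (hw : ∀ a, star (w a) = w a) (hy : ∀ a, star (y a) = y a)
    (hc : ∀ a b, v a * w b = w b * v a) (hyvw : ∀ i j, y (i, j) = ∑ k, v (i, k) * w (k, j))
    (h1 : ∀ P ∈ orthogonalRel N, eval v hv P = 0) (h2 : ∀ P ∈ orthogonalRel N, eval w hw P = 0) :
    ∀ P ∈ orthogonalRel N, eval y hy P = 0 := by
  have h (v : Fin N × Fin N → T) (hv : ∀ a, star (v a) = v a)
      (h1 : ∀ P ∈ orthogonalRel N, eval v hv P = 0) (i j : Fin N) :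
      (∑ k, v (i, k) * v (j, k) = if i = j then 1 else 0) ∧
        ∑ k, v (k, i) * v (k, j) = if i = j then 1 else 0 := by
    have ha := h1 _ (Or.inl ⟨i, j, rfl⟩)
    have hb := h1 _ (Or.inr ⟨i, j, rfl⟩)
    rw [map_sub, sub_eq_zero, apply_ite (eval _ _), map_one, map_zero] at ha hb
    exact ⟨by simpa using ha, by simpa using hb⟩
  rintro P (⟨i, j, rfl⟩ | ⟨i, j, rfl⟩)
  · rw [map_sub, sub_eq_zero, apply_ite (eval _ _), map_one, map_zero, map_sum]
    simp only [map_mul, eval_X]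
    simp_rw [mul_expand hc hyvw]
    rw [Finset.sum_comm]
    simp_rw [Finset.sum_comm (s := (Finset.univ : Finset (Fin N))) (t := Finset.univ)
      (f := fun p l => v (i, _) * v (j, l) * (w (_, p) * w (l, p)))]
    simp_rw [← Finset.mul_sum, (h w hw h2 _ _).1]
    simp [(h v hv h1 i j).1]
  · rw [map_sub, sub_eq_zero, apply_ite (eval _ _), map_one, map_zero, map_sum]
    simp only [map_mul, eval_X]
    simp_rw [mul_expand hc hyvw]
    rw [Finset.sum_comm]
    simp_rw [Finset.sum_comm (s := (Finset.univ : Finset (Fin N))) (t := Finset.univ)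
      (f := fun p l => v (p, _) * v (p, l) * (w (_, i) * w (l, j)))]
    simp_rw [← Finset.sum_mul, (h v hv h1 _ _).2]
    simp [(h w hw h2 i j).2]

end stable

/-- The quantum subgroup of the free orthogonal quantum group obtained by imposing the relations
`P = 0`, `P ∈ R`, on the standard coordinates. -/
def QuantumSubgroup.ofRel (τ : TensorKind) {N : ℕ} (R : Set (NCPoly (Fin N × Fin N)))
    (hR : IsMultiplicativeRel R) : QuantumSubgroup τ N where
  alg := UniversalCStar (orthogonalRel N ∪ R) (isBoundedRel_orthogonal R)
  u i j := UniversalCStar.gen _ _ (i, j)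
  star_u i j := UniversalCStar.star_gen (i, j)
  row_orth i j := by
    have := UniversalCStar.relation (hR := isBoundedRel_orthogonal R) (Or.inl (Or.inl ⟨i, j, rfl⟩))
    rw [map_sub, sub_eq_zero, apply_ite (eval _ _), map_one, map_zero] at this
    simpa using this
  col_orth i j := by
    have := UniversalCStar.relation (hR := isBoundedRel_orthogonal R) (Or.inl (Or.inr ⟨i, j, rfl⟩))
    rw [map_sub, sub_eq_zero, apply_ite (eval _ _), map_one, map_zero] at this
    simpa using this
  generates := UniversalCStar.generates
  exists_comul := by
    let A := UniversalCStar (orthogonalRel N ∪ R) (isBoundedRel_orthogonal R)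
    let u : Fin N × Fin N → A := UniversalCStar.gen _ _
    have hu (a) : star (u a) = u a := UniversalCStar.star_gen a
    let v (a : Fin N × Fin N) : τ.tensor A A := τ.inl (u a)
    let w (a : Fin N × Fin N) : τ.tensor A A := τ.inr (u a)
    let y (a : Fin N × Fin N) : τ.tensor A A := ∑ k, τ.tmul (u (a.1, k)) (u (k, a.2))
    have hv (a) : star (v a) = v a := by rw [← map_star, hu]
    have hw (a) : star (w a) = w a := by rw [← map_star, hu]
    have hy (a) : star (y a) = y a := by
      simp only [y, star_sum, TensorKind.star_tmul, hu]
    have hc (a b) : v a * w b = w b * v a := by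
      rw [TensorKind.inl_mul_inr, TensorKind.inr_mul_inl]
    have hyvw (i j) : y (i, j) = ∑ k, v (i, k) * w (k, j) := by
      simp only [y, v, w, TensorKind.inl_mul_inr]
    have h1 : ∀ P ∈ orthogonalRel N ∪ R, eval v hv P = 0 := fun P hP => by
      rw [eval_comp τ.inl u hu, UniversalCStar.relation hP, map_zero]
    have h2 : ∀ P ∈ orthogonalRel N ∪ R, eval w hw P = 0 := fun P hP => by
      rw [eval_comp τ.inr u hu, UniversalCStar.relation hP, map_zero]
    have h3 : ∀ P ∈ orthogonalRel N ∪ R, eval y hy P = 0 := by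
      rintro P (hP | hP)
      · exact orthogonal_mul hv hw hy hc hyvw (fun P hP => h1 P (Or.inl hP))
          (fun P hP => h2 P (Or.inl hP)) P hP
      · exact hR _ v w y hv hw hy hc hyvw h1 h2 P hP
    obtain ⟨Δ, hΔ⟩ := UniversalCStar.exists_lift (hR := isBoundedRel_orthogonal R) y hy h3
    exact ⟨Δ, fun i j => hΔ (i, j)⟩

/-- The half-liberated hyperoctahedral quantum group: `a b c = c b a` for all the coordinates, and
`a b = 0` whenever `a ≠ b` are on the same row or column. -/
def halfHyperoctahedral (τ : TensorKind) (N : ℕ) : QuantumSubgroup τ N :=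
  .ofRel τ (halfCommRel (Fin N × Fin N) ∪ cubicRel N) isMultiplicativeRel_half_cubic

/-- The higher hyperoctahedral quantum group: `a b c = 0` whenever `a ≠ c` are coordinates on the
same row or column, with `b` an arbitrary coordinate. -/
def higherHyperoctahedral (τ : TensorKind) (N : ℕ) : QuantumSubgroup τ N :=
  .ofRel τ (higherCubicRel N) isMultiplicativeRel_higherCubic

/-! ### The hyperoctahedral group -/

/-- The hyperoctahedral group, formed by the signed permutation matrices: `e_j ↦ ± e_{σ j}`. -/
def hyperoctahedralGroup (N : ℕ) : Submonoid (Matrix (Fin N) (Fin N) ℝ) where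
  carrier := {U | ∃ (σ : Equiv.Perm (Fin N)) (ε : Fin N → ℤˣ),
    U = Matrix.of fun i j => if i = σ j then ((ε i : ℤ) : ℝ) else 0}
  one_mem' := ⟨1, 1, by ext i j; simp [Matrix.one_apply]⟩
  mul_mem' := by
    rintro _ _ ⟨σ, ε, rfl⟩ ⟨σ', ε', rfl⟩
    refine ⟨σ * σ', fun i => ε i * ε' (σ⁻¹ i), ?_⟩
    ext i j
    simp only [Matrix.mul_apply, Matrix.of_apply]
    rw [Finset.sum_eq_single (σ' j)]
    · by_cases h : i = σ (σ' j)
      · subst h; simp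
      · simp [h]
    · intro k _ hk; simp [hk]
    · simp

instance (N : ℕ) : Finite (hyperoctahedralGroup N) := by
  have : (hyperoctahedralGroup N : Set (Matrix (Fin N) (Fin N) ℝ)) ⊆
      Set.range fun p : Equiv.Perm (Fin N) × (Fin N → ℤˣ) =>
        (Matrix.of fun i j => if i = p.1 j then ((p.2 i : ℤ) : ℝ) else 0 :
          Matrix (Fin N) (Fin N) ℝ) := by
    rintro _ ⟨σ, ε, rfl⟩; exact ⟨(σ, ε), rfl⟩
  exact (Set.finite_range _).subset this

theorem hyperoctahedralGroup.orthogonal {N : ℕ} (U : hyperoctahedralGroup N) :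
    U.1 * U.1.transpose = 1 ∧ U.1.transpose * U.1 = 1 := by
  have key : U.1 * U.1.transpose = 1 := by
    obtain ⟨_, σ, ε, rfl⟩ := U
    ext i j
    simp only [Matrix.mul_apply, Matrix.transpose_apply, Matrix.of_apply, Matrix.one_apply]
    rw [Finset.sum_eq_single (σ⁻¹ i)]
    · by_cases h : i = j
      · subst h
        simp [← Int.cast_mul, ← Units.val_mul]
      · simp [h, Ne.symm h]
    · intro k _ hk
      rw [if_neg, zero_mul]
      rintro rfl; simp at hk
    · simp
  exact ⟨key, mul_eq_one_comm.1 key⟩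

theorem exists_comul_finite (τ : TensorKind) (M : Type) [Monoid M] [TopologicalSpace M] [Finite M]
    [DiscreteTopology M] {κ : Type} [Fintype κ] :
    ∃ Δ : C(M, ℂ) →⋆ₐ[ℂ] τ.tensor C(M, ℂ) C(M, ℂ),
      ∀ (f : C(M, ℂ)) (a b : κ → C(M, ℂ)), (∀ g h, f (g * h) = ∑ k, a k g * b k h) →
        Δ f = ∑ k, τ.tmul (a k) (b k) := by
  classical
  cases nonempty_fintype M
  let e (g : M) : C(M, ℂ) := ⟨fun h => if h = g then 1 else 0, continuous_of_discreteTopology⟩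
  have he (g h : M) : e g * e h = if g = h then e g else 0 := by
    ext x; by_cases h1 : g = h <;> by_cases h2 : x = g <;> simp_all [e]
  have hse (g : M) : star (e g) = e g := by
    ext x; by_cases h2 : x = g <;> simp_all [e]
  have hsum (f : C(M, ℂ)) : f = ∑ g, f g • e g := by
    ext x; simp [e]
  have hone : ∑ g, e g = 1 := by ext x; simp [e]
  let E (p : M × M) : τ.tensor C(M, ℂ) C(M, ℂ) := τ.tmul (e p.1) (e p.2)
  have hE (p q : M × M) : E p * E q = if p = q then E p else 0 := by
    simp only [E, TensorKind.tmul_mul, he]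
    by_cases h1 : p.1 = q.1 <;> by_cases h2 : p.2 = q.2 <;>
      simp [h1, h2, Prod.ext_iff, ← TensorKind.inl_mul_inr]
  have hE1 : ∑ p, E p = 1 := by
    simp only [E, ← TensorKind.inl_mul_inr, Fintype.sum_prod_type]
    rw [← Finset.sum_mul_sum, ← map_sum, ← map_sum, hone, map_one, map_one, mul_one]
  let D : C(M, ℂ) →⋆ₐ[ℂ] τ.tensor C(M, ℂ) C(M, ℂ) :=
    { toFun := fun f => ∑ p, f (p.1 * p.2) • E p
      map_one' := by simpa using hE1
      map_zero' := by simp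
      map_add' := fun f f' => by simp [add_smul, Finset.sum_add_distrib]
      map_mul' := fun f f' => by
        rw [Finset.sum_mul_sum]
        simp [hE, smul_smul, mul_comm]
      commutes' := fun c => by
        simp [Algebra.algebraMap_eq_smul_one, ← Finset.smul_sum, hE1]
      map_star' := fun f => by
        simp only [star_sum, star_smul, E, TensorKind.star_tmul, hse]
        rfl }
  refine ⟨D, fun f a b hab => ?_⟩
  change ∑ p : M × M, f (p.1 * p.2) • E p = _
  have h (a b : C(M, ℂ)) : τ.tmul a b = ∑ p : M × M, (a p.1 * b p.2) • E p := by
    rw [← TensorKind.inl_mul_inr]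
    nth_rewrite 1 [hsum a, hsum b]
    simp only [map_sum, map_smul]
    rw [Finset.sum_mul_sum, Fintype.sum_prod_type]
    simp [E, TensorKind.inl_mul_inr, smul_smul, mul_comm]
  simp_rw [h, hab, Finset.sum_smul]
  exact Finset.sum_comm

theorem hyperoctahedralGroup.continuous_entry {N : ℕ} (i j : Fin N) :
    Continuous fun U : hyperoctahedralGroup N => ((U.1 i j : ℝ) : ℂ) :=
  continuous_of_discreteTopology

/-- The hyperoctahedral group as a quantum group, with its algebra of (continuous) functions. -/
def hyperoctahedral (τ : TensorKind) (N : ℕ) : QuantumSubgroup τ N where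
  alg := C(hyperoctahedralGroup N, ℂ)
  u i j := ⟨fun U => ((U.1 i j : ℝ) : ℂ), hyperoctahedralGroup.continuous_entry i j⟩
  star_u i j := by ext U; simp
  row_orth i j := by
    ext U
    have h := congrFun (congrFun (hyperoctahedralGroup.orthogonal U).1 i) j
    simp only [Matrix.mul_apply, Matrix.transpose_apply, Matrix.one_apply] at h
    have h' := congrArg (fun r : ℝ => (r : ℂ)) h
    rw [apply_ite (DFunLike.coe · U)]
    simpa [apply_ite (fun r : ℝ => (r : ℂ))] using h'
  col_orth i j := by
    ext U
    have h := congrFun (congrFun (hyperoctahedralGroup.orthogonal U).2 i) j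
    simp only [Matrix.mul_apply, Matrix.transpose_apply, Matrix.one_apply] at h
    have h' := congrArg (fun r : ℝ => (r : ℂ)) h
    rw [apply_ite (DFunLike.coe · U)]
    simpa [apply_ite (fun r : ℝ => (r : ℂ))] using h'
  generates := by
    apply ContinuousMap.starSubalgebra_topologicalClosure_eq_top_of_separatesPoints
    intro p q hpq
    obtain ⟨i, j, hi⟩ : ∃ i j, p.1 i j ≠ q.1 i j := by
      by_contra! h
      exact hpq (Subtype.ext (Matrix.ext h))
    refine ⟨_, ⟨⟨fun U => ((U.1 i j : ℝ) : ℂ), hyperoctahedralGroup.continuous_entry i j⟩,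
      StarAlgebra.subset_adjoin ℂ _ ⟨(i, j), rfl⟩, rfl⟩, ?_⟩
    simpa using hi
  exists_comul := by
    obtain ⟨Δ, hΔ⟩ := exists_comul_finite τ (hyperoctahedralGroup N) (κ := Fin N)
    refine ⟨Δ, fun i j => hΔ _ _ _ fun g h => ?_⟩
    simp [Matrix.mul_apply]

/-! ### Actions -/

/-- `G` acts affinely on `X`: there is a morphism of C*-algebras `C(X) → C(G) ⊗ C(X)` with
`x i ↦ ∑ j, u i j ⊗ x j`. -/
def QuantumSubgroup.ActsOn {τ : TensorKind} {N : ℕ} (G : QuantumSubgroup τ N)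
    (S : SphereSubspace N) : Prop :=
  ∃ Φ : S.alg →⋆ₐ[ℂ] τ.tensor G.alg S.alg, ∀ i, Φ (S.x i) = ∑ j, τ.tmul (G.u i j) (S.x j)

end

/-! Put $X_i=\sum_j u_{ij}\otimes x_j$. For the four spheres given by a universal algebra it
suffices, by the universal property, that the $X_i$ satisfy the defining relations (`actsOn_ofRel`).
The relation $\sum_i X_i^2=1$ follows from the orthogonality of the columns of $u$.

For $(P_d)$, expand $X_{i_0}\cdots X_{i_d}=\sum_j u_{i_0j_0}\cdots u_{i_dj_d}\otimes x_{j_0}\cdots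
x_{j_d}$ with the $i_k$ distinct (`prod_coact`). If the $j_k$ are distinct, the right leg vanishes
by $(P_d)$ in the sphere. Otherwise the left leg contains two entries of the same column with zero
product, possibly with other letters between them. It vanishes all the same, because squares of
entries commute with entries: for a word $w$, $ww^*$ is then the product of the squares of its
letters, the two offending squares can be brought together, and the C*-identity gives $w=0$
(`map_prod_eq_zero_of_not_pairwise`).

So two properties of the quantum group are needed: zero products along rows and columns, and central
squares of entries. The second is clear for $H_N$, is the case $aab=baa$ of half-commutation for
$H_N^*$, and for $H_N^{[\infty]}$ comes from inserting $\sum_k u_{ik}^2=1$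
(`higherHyperoctahedral_hasCommutingSquares`).

The (twisted, half-) commutation relations are compared term by term: the entries of $u$ commute or
half-commute, the coordinates $x_i$ supply the sign, and each term whose sign would be wrong has a
zero left leg. The classical sphere is an algebra of functions rather than a universal algebra, and
there the coaction is built from the action of $H_N$ on points. -/

open NCPoly

/-! ### Bilinearity of elementary tensors -/

section

variable {A B : Type} [CStarAlgebra A] [CStarAlgebra B] (τ : TensorKind)

@[simp] theorem TensorKind.zero_tmul (b : B) : τ.tmul (0 : A) b = 0 := by
  rw [← inl_mul_inr, map_zero, zero_mul]

@[simp] theorem TensorKind.tmul_zero (a : A) : τ.tmul a (0 : B) = 0 := by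
  rw [← inl_mul_inr, map_zero, mul_zero]

theorem TensorKind.tmul_neg (a : A) (b : B) : τ.tmul a (-b) = -τ.tmul a b := by
  rw [← inl_mul_inr, map_neg, mul_neg, inl_mul_inr]

theorem TensorKind.sum_tmul {ι : Type*} (s : Finset ι) (a : ι → A) (b : B) :
    τ.tmul (∑ i ∈ s, a i) b = ∑ i ∈ s, τ.tmul (a i) b := by
  simp only [← inl_mul_inr, map_sum, Finset.sum_mul]

theorem TensorKind.tmul_sum {ι : Type*} (s : Finset ι) (a : A) (b : ι → B) :
    τ.tmul a (∑ i ∈ s, b i) = ∑ i ∈ s, τ.tmul a (b i) := by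
  simp only [← inl_mul_inr, map_sum, Finset.mul_sum]

theorem TensorKind.tmul_one_one : τ.tmul (1 : A) (1 : B) = 1 := by
  rw [← inl_mul_inr, map_one, map_one, mul_one]

end

/-! ### Words in self-adjoint elements with commuting squares -/

section words

variable {I A : Type} [CStarAlgebra A] {v : I → A}

/-- With $w$ the tail, the left side is $v_a\,ww^*\,v_a$, and $ww^*$ moves past the last letter.
Iterating this writes $ww^*$ as a product of squares of letters. -/
theorem map_prod_mul_star_cons (hv : ∀ a, star (v a) = v a) (a : I) (l : List I)
    (hl : Commute ((l.map v).prod * star (l.map v).prod) (v a)) :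
    (((a :: l).map v).prod * star ((a :: l).map v).prod) =
      v a * v a * ((l.map v).prod * star (l.map v).prod) := by
  rw [List.map_cons, List.prod_cons, star_mul, hv, mul_assoc, ← mul_assoc _ (star _), hl.eq,
    ← mul_assoc]

/-- By induction $ww^*$ is a product of squares, each of which commutes with every letter. -/
theorem commute_map_prod_mul_star (hv : ∀ a, star (v a) = v a)
    (hsq : ∀ a b, Commute (v a * v a) (v b)) (l : List I) (b : I) :
    Commute ((l.map v).prod * star (l.map v).prod) (v b) := by
  induction l generalizing b with
  | nil => simp
  | cons a l ih =>
    rw [map_prod_mul_star_cons hv a l (ih a)]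
    exact (hsq a b).mul_left (ih b)

/-- In the product of squares $ww^*$, the factor $v_a^2$ can be moved next to $v_c^2$, and
$v_a^2v_c^2=v_a(v_av_c)v_c=0$. -/
theorem sq_mul_map_prod_mul_star_eq_zero (hv : ∀ a, star (v a) = v a)
    (hsq : ∀ a b, Commute (v a * v a) (v b)) {a c : I} (hac : v a * v c = 0) {l : List I}
    (hc : c ∈ l) : v a * v a * ((l.map v).prod * star (l.map v).prod) = 0 := by
  induction l with
  | nil => simp at hc
  | cons b l ih =>
    rw [map_prod_mul_star_cons hv b l (commute_map_prod_mul_star hv hsq l b)]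
    rcases List.mem_cons.1 hc with rfl | hc
    · have h : v a * v a * (v c * v c) = 0 := by
        rw [mul_assoc, ← mul_assoc (v a) (v c), hac, zero_mul, mul_zero]
      rw [← mul_assoc, h, zero_mul]
    · rw [← mul_assoc, ((hsq a b).mul_right (hsq a b)).eq, mul_assoc, ih hc, mul_zero]

/-- A word vanishes as soon as two of its letters have product zero, provided that the squares of
the letters commute with all the letters. -/
theorem map_prod_eq_zero_of_not_pairwise (hv : ∀ a, star (v a) = v a)
    (hsq : ∀ a b, Commute (v a * v a) (v b)) {l : List I}
    (hl : ¬ l.Pairwise fun a c => v a * v c ≠ 0) : (l.map v).prod = 0 := by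
  -- The C*-identity replaces the word, whose letters need not commute, by $ww^*$, which factors
  -- into squares.
  rw [← CStarRing.mul_star_self_eq_zero_iff]
  induction l with
  | nil => simp at hl
  | cons a l ih =>
    rw [map_prod_mul_star_cons hv a l (commute_map_prod_mul_star hv hsq l a)]
    -- Either the bad pair involves the head, whose square then annihilates the rest, or it lies in
    -- the tail.
    by_cases h : l.Pairwise fun a c => v a * v c ≠ 0
    · obtain ⟨c, hc, hac⟩ : ∃ c ∈ l, v a * v c = 0 := by
        by_contra! h'
        exact hl (List.pairwise_cons.2 ⟨h', h⟩)
      exact sq_mul_map_prod_mul_star_eq_zero hv hsq hac hc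
    · rw [ih h, mul_zero]

end words

/-! ### The coaction on the coordinates -/

namespace QuantumSubgroup

variable {τ : TensorKind} {N : ℕ} (G : QuantumSubgroup τ N)

/-- The entries on the same row or column have product zero. -/
def IsCubic : Prop := ∀ a b : Fin N × Fin N, SameLine a b → G.u a.1 a.2 * G.u b.1 b.2 = 0

/-- The squares of the entries commute with the entries. -/
def HasCommutingSquares : Prop :=
  ∀ a b : Fin N × Fin N, Commute (G.u a.1 a.2 * G.u a.1 a.2) (G.u b.1 b.2)

/-- The entries half-commute. -/
def HalfCommutes : Prop :=
  ∀ a b c : Fin N × Fin N, G.u a.1 a.2 * G.u b.1 b.2 * G.u c.1 c.2 =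
    G.u c.1 c.2 * G.u b.1 b.2 * G.u a.1 a.2

variable {G} in
-- Half-commutation with a repeated letter: $aab=baa$.
theorem HalfCommutes.hasCommutingSquares (h : G.HalfCommutes) : G.HasCommutingSquares :=
  fun a b => by
    have := h a a b
    rw [Commute, SemiconjBy, this, mul_assoc]

section sphere

variable (S : SphereSubspace N)

/-- The elements `∑ j, u i j ⊗ x j`. -/
noncomputable def coact (i : Fin N) : τ.tensor G.alg S.alg := ∑ j, τ.tmul (G.u i j) (S.x j)

theorem star_coact (i : Fin N) : star (G.coact S i) = G.coact S i := by
  simp only [coact, star_sum, TensorKind.star_tmul, G.star_u, S.star_x]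

theorem coact_mul (i j : Fin N) : G.coact S i * G.coact S j =
    ∑ p, ∑ q, τ.tmul (G.u i p * G.u j q) (S.x p * S.x q) := by
  simp only [coact, Finset.sum_mul_sum, TensorKind.tmul_mul]

theorem coact_mul_mul (i j k : Fin N) : G.coact S i * G.coact S j * G.coact S k =
    ∑ p, ∑ q, ∑ r, τ.tmul (G.u i p * G.u j q * G.u k r) (S.x p * S.x q * S.x r) := by
  rw [coact_mul]
  simp only [coact, Finset.sum_mul]
  simp only [Finset.mul_sum, TensorKind.tmul_mul]

theorem sum_coact_sq : ∑ i, G.coact S i * G.coact S i = 1 := by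
  simp_rw [coact_mul]
  rw [Finset.sum_comm]
  -- The sum over $i$ is made innermost, so that `col_orth` collapses $\sum_i u_{ip}u_{iq}$ to
  -- $\delta_{pq}$.
  simp_rw [Finset.sum_comm (s := (Finset.univ : Finset (Fin N))) (t := Finset.univ)
    (f := fun i q => τ.tmul (G.u i _ * G.u i q) (S.x _ * S.x q)), ← TensorKind.sum_tmul,
    G.col_orth]
  have h (p q : Fin N) : τ.tmul (if p = q then (1 : G.alg) else 0) (S.x p * S.x q) =
      if p = q then τ.tmul 1 (S.x p * S.x q) else 0 := by
    split_ifs <;> simp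
  simp only [h, Finset.sum_ite_eq, Finset.mem_univ, if_true]
  rw [← TensorKind.tmul_sum, S.sum_sq, TensorKind.tmul_one_one]

theorem prod_coact (n : ℕ) (i : Fin n → Fin N) : (List.ofFn fun k => G.coact S (i k)).prod =
    ∑ j : Fin n → Fin N, τ.tmul (List.ofFn fun k => G.u (i k) (j k)).prod
      (List.ofFn fun k => S.x (j k)).prod := by
  induction n with
  | zero => simp [TensorKind.tmul_one_one]
  | succ n ih =>
    -- A multi-index of length $n+1$ is split into its first entry and a multi-index of length $n$.
    rw [← (Fin.consEquiv fun _ => Fin N).sum_comp, Fintype.sum_prod_type, List.ofFn_succ,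
      List.prod_cons, ih fun k => i k.succ, coact, Finset.sum_mul_sum]
    simp [List.ofFn_succ, TensorKind.tmul_mul, Fin.consEquiv]

variable {G S}

/-- In each term of `prod_coact`, either the column indices are distinct and the word in the $x_j$
vanishes, or two of them agree and the word in the $u_{ij}$ vanishes, since the row indices are
distinct. -/
theorem prod_coact_eq_zero (h0 : G.IsCubic) (hsq : G.HasCommutingSquares) {d : ℕ}
    (hS : ∀ i : Fin (d + 1) → Fin N, Function.Injective i →
      (List.ofFn fun k => S.x (i k)).prod = 0)
    (i : Fin (d + 1) → Fin N) (hi : Function.Injective i) :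
    (List.ofFn fun k => G.coact S (i k)).prod = 0 := by
  rw [prod_coact]
  refine Finset.sum_eq_zero fun j _ => ?_
  by_cases hj : Function.Injective j
  · rw [hS j hj, TensorKind.tmul_zero]
  · have h : (List.ofFn fun k => G.u (i k) (j k)) =
        (List.ofFn fun k => (i k, j k)).map fun a => G.u a.1 a.2 := by
      rw [List.map_ofFn]; rfl
    rw [h, map_prod_eq_zero_of_not_pairwise (fun a => G.star_u a.1 a.2) hsq,
      TensorKind.zero_tmul]
    rw [List.pairwise_ofFn]
    intro hp
    refine hj fun a b hab => ?_
    by_contra hne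
    -- Pairwise conditions on a list only see ordered positions, so the repeated column is treated
    -- with $a<b$ and the general case follows by symmetry.
    have key (a b : Fin (d + 1)) (hlt : a < b) (hab : j a = j b) : False :=
      hp hlt (h0 _ _ ⟨fun h => hlt.ne (hi (Prod.ext_iff.1 h).1), Or.inr hab⟩)
    rcases lt_or_gt_of_ne hne with h | h
    · exact key _ _ h hab
    · exact key _ _ h hab.symm

/-- The sign comes from the $x_p$ when $p\ne q$; the diagonal terms, where the $x_p$ give no sign,
are killed by $u_{ip}u_{jp}=0$. -/
theorem coact_anticomm (h0 : G.IsCubic)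
    (hG : ∀ a b : Fin N × Fin N, G.u a.1 a.2 * G.u b.1 b.2 = G.u b.1 b.2 * G.u a.1 a.2)
    (hS : ∀ i j, i ≠ j → S.x i * S.x j = -(S.x j * S.x i)) {i j : Fin N} (hij : i ≠ j) :
    G.coact S i * G.coact S j = -(G.coact S j * G.coact S i) := by
  -- The exchange pairs the term $(p,q)$ of $X_iX_j$ with the term $(q,p)$ of $X_jX_i$.
  rw [coact_mul, coact_mul, Finset.sum_comm (γ := Fin N), ← Finset.sum_neg_distrib]
  refine Finset.sum_congr rfl fun q _ => ?_
  rw [← Finset.sum_neg_distrib]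
  refine Finset.sum_congr rfl fun p _ => ?_
  by_cases hpq : p = q
  · rw [h0 (i, p) (j, q) ⟨by simp [hij], Or.inr hpq⟩,
      h0 (j, q) (i, p) ⟨by simp [hij.symm], Or.inr hpq.symm⟩]
    simp
  · rw [hS p q hpq, hG (i, p) (j, q), TensorKind.tmul_neg]

/-- Common to the untwisted and twisted relations: `f` is the identity in the former and negation in
the latter, and being additive it passes through the sums. -/
theorem coact_mul_mul_congr {i j k : Fin N} {f : τ.tensor G.alg S.alg →+ τ.tensor G.alg S.alg}
    (h : ∀ p q r, τ.tmul (G.u i p * G.u j q * G.u k r) (S.x p * S.x q * S.x r) =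
      f (τ.tmul (G.u k r * G.u j q * G.u i p) (S.x r * S.x q * S.x p))) :
    G.coact S i * G.coact S j * G.coact S k =
      f (G.coact S k * G.coact S j * G.coact S i) := by
  rw [coact_mul_mul, coact_mul_mul]
  simp only [map_sum, h]
  -- Three adjacent exchanges turn the order of summation $p,q,r$ into $r,q,p$.
  rw [Finset.sum_comm]
  refine (Finset.sum_congr rfl fun q _ => Finset.sum_comm).trans ?_
  rw [Finset.sum_comm]

theorem coact_halfComm (hG : G.HalfCommutes)
    (hS : ∀ i j k, S.x i * S.x j * S.x k = S.x k * S.x j * S.x i) (i j k : Fin N) :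
    G.coact S i * G.coact S j * G.coact S k = G.coact S k * G.coact S j * G.coact S i :=
  coact_mul_mul_congr (f := .id _) fun p q r => by
    rw [hG (i, p) (j, q) (k, r), hS p q r]; rfl

/-- The substantial case is that of the two outer letters, which are not adjacent; it rests on the
vanishing of words with commuting squares. -/
theorem IsCubic.mul_mul_eq_zero (h0 : G.IsCubic) (hG : G.HalfCommutes) {a b c : Fin N × Fin N}
    (h : SameLine a b ∨ SameLine b c ∨ SameLine a c) :
    G.u a.1 a.2 * G.u b.1 b.2 * G.u c.1 c.2 = 0 := by
  have key : ([a, b, c].map fun a => G.u a.1 a.2).prod = 0 := by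
    refine map_prod_eq_zero_of_not_pairwise (fun a => G.star_u a.1 a.2)
      hG.hasCommutingSquares fun hp => ?_
    simp only [List.pairwise_cons, List.mem_cons, List.not_mem_nil, or_false, forall_eq_or_imp,
      forall_eq] at hp
    rcases h with h | h | h
    · exact hp.1.1 (h0 _ _ h)
    · exact hp.2.1 (h0 _ _ h)
    · exact hp.1.2 (h0 _ _ h)
  simpa [mul_assoc] using key

/-- Terms with distinct columns $p,q,r$ get their sign from the $x_p$. If two columns agree, the
rows being distinct, the left leg contains two entries of one column and vanishes. -/
theorem coact_twistedHalfComm (h0 : G.IsCubic) (hG : G.HalfCommutes)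
    (hS : ∀ i j k, i ≠ j ∧ j ≠ k ∧ i ≠ k → S.x i * S.x j * S.x k = -(S.x k * S.x j * S.x i))
    {i j k : Fin N} (h : i ≠ j ∧ j ≠ k ∧ i ≠ k) :
    G.coact S i * G.coact S j * G.coact S k = -(G.coact S k * G.coact S j * G.coact S i) :=
  coact_mul_mul_congr (f := negAddMonoidHom) fun p q r => by
    change _ = -_
    rw [hG (k, r) (j, q) (i, p)]
    by_cases hp : p ≠ q ∧ q ≠ r ∧ p ≠ r
    · rw [hS p q r hp, TensorKind.tmul_neg]
    · rw [h0.mul_mul_eq_zero hG (a := (i, p)) (b := (j, q)) (c := (k, r))]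
      · simp
      · simp only [SameLine, ne_eq, Prod.mk.injEq]; grind

/-- Here the terms with distinct $p,q,r$ carry the wrong sign. As two of the rows $i,j,k$ agree,
their left leg contains two distinct entries of one row and vanishes. -/
theorem coact_twistedHalfComm' (h0 : G.IsCubic) (hG : G.HalfCommutes)
    (hS : ∀ i j k, ¬(i ≠ j ∧ j ≠ k ∧ i ≠ k) → S.x i * S.x j * S.x k = S.x k * S.x j * S.x i)
    {i j k : Fin N} (h : ¬(i ≠ j ∧ j ≠ k ∧ i ≠ k)) :
    G.coact S i * G.coact S j * G.coact S k = G.coact S k * G.coact S j * G.coact S i :=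
  coact_mul_mul_congr (f := .id _) fun p q r => by
    change _ = τ.tmul _ _
    rw [hG (k, r) (j, q) (i, p)]
    by_cases hp : p ≠ q ∧ q ≠ r ∧ p ≠ r
    · rw [h0.mul_mul_eq_zero hG (a := (i, p)) (b := (j, q)) (c := (k, r))]
      · simp
      · simp only [SameLine, ne_eq, Prod.mk.injEq]; grind
    · rw [hS p q r hp]

end sphere

/-- A quantum group acts on the subspace of the free sphere defined by the relations `R`, as soon
as the elements `∑ j, u i j ⊗ x j` satisfy these relations. -/
theorem actsOn_ofRel {R : Set (NCPoly (Fin N))}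
    (h : ∀ P ∈ R, eval (G.coact (.ofRel R)) (G.star_coact _) P = 0) :
    G.ActsOn (.ofRel R) := by
  refine UniversalCStar.exists_lift (hR := isBoundedRel_sphere R) (G.coact (.ofRel R))
    (G.star_coact _) ?_
  rintro P (rfl | hP)
  · simpa [sub_eq_zero] using G.sum_coact_sq (.ofRel R)
  · exact h P hP

end QuantumSubgroup

/-! ### Relations in the universal spheres and transfer of the polygonal ones -/

theorem SphereSubspace.eval_eq_zero {N : ℕ} {R : Set (NCPoly (Fin N))} {P : NCPoly (Fin N)}
    (hP : P ∈ R) :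
    eval (SphereSubspace.ofRel R).x (SphereSubspace.ofRel R).star_x P = 0 :=
  UniversalCStar.relation (hR := isBoundedRel_sphere R) (Or.inr hP)

theorem SphereSubspace.prod_eq_zero {N d : ℕ} {R : Set (NCPoly (Fin N))}
    (hR : polygonalRel N d ⊆ R) (i : Fin (d + 1) → Fin N) (hi : Function.Injective i) :
    (List.ofFn fun k => (SphereSubspace.ofRel R).x (i k)).prod = 0 := by
  have h := SphereSubspace.eval_eq_zero (hR ⟨i, hi, rfl⟩)
  rw [map_list_prod, List.map_ofFn] at h
  simpa [Function.comp_def] using h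

/-- The set `R` is left free so that this covers the polygonal part of all four universal spheres.
-/
theorem QuantumSubgroup.eval_coact_polygonal {τ : TensorKind} {N d : ℕ} {G : QuantumSubgroup τ N}
    (h0 : G.IsCubic) (hsq : G.HasCommutingSquares) {R : Set (NCPoly (Fin N))}
    (hR : polygonalRel N d ⊆ R) {P : NCPoly (Fin N)} (hP : P ∈ polygonalRel N d) :
    eval (G.coact (.ofRel R)) (G.star_coact _) P = 0 := by
  obtain ⟨i, hi, rfl⟩ := hP
  rw [map_list_prod, List.map_ofFn]
  simpa [Function.comp_def] using
    G.prod_coact_eq_zero h0 hsq (SphereSubspace.prod_eq_zero hR) i hi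

/-! ### The relations between the entries of the hyperoctahedral quantum groups -/

section entries

variable (τ : TensorKind) (N : ℕ)

theorem hyperoctahedral_comm (a b : Fin N × Fin N) :
    (hyperoctahedral τ N).u a.1 a.2 * (hyperoctahedral τ N).u b.1 b.2 =
      (hyperoctahedral τ N).u b.1 b.2 * (hyperoctahedral τ N).u a.1 a.2 :=
  mul_comm (G := C(hyperoctahedralGroup N, ℂ)) _ _

theorem hyperoctahedral_hasCommutingSquares : (hyperoctahedral τ N).HasCommutingSquares :=
  fun a b => Commute.mul_left (hyperoctahedral_comm τ N a b) (hyperoctahedral_comm τ N a b)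

/-- At a signed permutation matrix each row and each column has a single nonzero entry, so two
entries of one line are never both nonzero. -/
theorem hyperoctahedral_isCubic : (hyperoctahedral τ N).IsCubic := by
  rintro ⟨i, p⟩ ⟨j, q⟩ ⟨hne, hl⟩
  refine ContinuousMap.ext (Y := ℂ) fun U => ?_
  obtain ⟨_, σ, ε, rfl⟩ := U
  change (((if i = σ p then _ else 0 : ℝ) : ℂ)) * (((if j = σ q then _ else 0 : ℝ) : ℂ)) = 0
  by_cases h1 : i = σ p
  · by_cases h2 : j = σ q
    · exfalso
      subst h1 h2
      rcases hl with h | h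
      · exact hne (Prod.ext h (σ.injective h))
      · exact hne (Prod.ext (congrArg σ h) h)
    · simp [h2]
  · simp [h1]

theorem QuantumSubgroup.ofRel_eval {N : ℕ} {R : Set (NCPoly (Fin N × Fin N))}
    (hR : IsMultiplicativeRel R) {P : NCPoly (Fin N × Fin N)} (hP : P ∈ R) :
    eval (fun a : Fin N × Fin N => (QuantumSubgroup.ofRel τ R hR).u a.1 a.2)
      (fun a => (QuantumSubgroup.ofRel τ R hR).star_u a.1 a.2) P = 0 :=
  UniversalCStar.relation (hR := isBoundedRel_orthogonal R) (Or.inr hP)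

theorem halfHyperoctahedral_halfCommutes : (halfHyperoctahedral τ N).HalfCommutes := fun a b c => by
  unfold halfHyperoctahedral
  have := QuantumSubgroup.ofRel_eval τ (isMultiplicativeRel_half_cubic (N := N))
    (Or.inl ⟨a, b, c, rfl⟩)
  simpa [sub_eq_zero] using this

theorem halfHyperoctahedral_isCubic : (halfHyperoctahedral τ N).IsCubic := fun a b h => by
  unfold halfHyperoctahedral
  have := QuantumSubgroup.ofRel_eval τ (isMultiplicativeRel_half_cubic (N := N))
    (Or.inr ⟨a, b, h, rfl⟩)
  simpa using this

theorem higherHyperoctahedral_mul_mul (a b c : Fin N × Fin N) (h : SameLine a c) :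
    (higherHyperoctahedral τ N).u a.1 a.2 * (higherHyperoctahedral τ N).u b.1 b.2 *
      (higherHyperoctahedral τ N).u c.1 c.2 = 0 := by
  unfold higherHyperoctahedral
  have := QuantumSubgroup.ofRel_eval τ (isMultiplicativeRel_higherCubic (N := N))
    ⟨a, b, c, h, rfl⟩
  simpa using this

/-- The cubic relation with $c=b$ gives $abb=0$, hence $(ab)(ab)^*=abba=0$. -/
theorem higherHyperoctahedral_isCubic : (higherHyperoctahedral τ N).IsCubic := fun a b h => by
  rw [← CStarRing.mul_star_self_eq_zero_iff, star_mul, QuantumSubgroup.star_u,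
    QuantumSubgroup.star_u, ← mul_assoc, higherHyperoctahedral_mul_mul τ N a b b h, zero_mul]

/-- For $a=u_{ij}$ and any entry $w$, multiplying by $\sum_k u_{ik}^2=1$ leaves only the term $k=j$,
because $aw\,u_{ik}=u_{ik}\,wa=0$ for $k\ne j$. Thus $aw=awa^2$ and $wa=a^2wa$, and both $a^2w$ and
$wa^2$ equal $a^2wa^2$. -/
theorem higherHyperoctahedral_hasCommutingSquares :
    (higherHyperoctahedral τ N).HasCommutingSquares := fun a b => by
  set G := higherHyperoctahedral τ N
  obtain ⟨i, j⟩ := a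
  set a := G.u i j
  set w := G.u b.1 b.2
  have hrow : ∑ k, G.u i k * G.u i k = 1 := by rw [G.row_orth, if_pos rfl]
  have hz (k : Fin N) (hk : k ≠ j) : a * w * G.u i k = 0 ∧ G.u i k * w * a = 0 :=
    ⟨higherHyperoctahedral_mul_mul τ N (i, j) b (i, k) ⟨by simp [hk.symm], Or.inl rfl⟩,
      higherHyperoctahedral_mul_mul τ N (i, k) b (i, j) ⟨by simp [hk], Or.inl rfl⟩⟩
  have h1 : a * w = a * w * (a * a) := by
    nth_rewrite 1 [← mul_one (a * w), ← hrow]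
    rw [Finset.mul_sum, Finset.sum_eq_single j]
    · intro k _ hk
      rw [← mul_assoc, (hz k hk).1, zero_mul]
    · simp
  have h2 : w * a = a * a * (w * a) := by
    nth_rewrite 1 [← one_mul (w * a), ← hrow]
    rw [Finset.sum_mul, Finset.sum_eq_single j]
    · intro k _ hk
      rw [mul_assoc, ← mul_assoc _ w, (hz k hk).2, mul_zero]
    · simp
  change a * a * w = w * (a * a)
  calc a * a * w = a * (a * w) := mul_assoc _ _ _
    -- Both sides are $a\,(awa^2)$, bracketed so that `h2` applies to $a^2(wa)$.
    _ = a * a * (w * a) * a := by rw [h1]; simp only [mul_assoc]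
    _ = w * (a * a) := by rw [← h2, mul_assoc]

end entries

/-! ### The action on the classical polygonal sphere -/

section classical

/-- An action of a finite monoid on a compact space, as a coaction on the algebras of functions. -/
theorem exists_coaction_finite (τ : TensorKind) (M Y : Type) [TopologicalSpace M] [Finite M]
    [DiscreteTopology M] [TopologicalSpace Y] [CompactSpace Y] (α : M → C(Y, Y)) {κ : Type}
    [Fintype κ] :
    ∃ Φ : C(Y, ℂ) →⋆ₐ[ℂ] τ.tensor C(M, ℂ) C(Y, ℂ),
      ∀ (f : C(Y, ℂ)) (a : κ → C(M, ℂ)) (b : κ → C(Y, ℂ)),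
        (∀ g y, f (α g y) = ∑ k, a k g * b k y) → Φ f = ∑ k, τ.tmul (a k) (b k) := by
  classical
  cases nonempty_fintype M
  let e (g : M) : C(M, ℂ) := ⟨fun h => if h = g then 1 else 0, continuous_of_discreteTopology⟩
  have he (g h : M) : e g * e h = if g = h then e g else 0 := by
    ext x; by_cases h1 : g = h <;> by_cases h2 : x = g <;> simp_all [e]
  have hse (g : M) : star (e g) = e g := by
    ext x; by_cases h2 : x = g <;> simp_all [e]
  have hsum (f : C(M, ℂ)) : f = ∑ g, f g • e g := by
    ext x; simp [e]
  have hone : ∑ g, e g = 1 := by ext x; simp [e]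
  -- Since $C(M)$ is spanned by the indicators $e_g$, the coaction is $f\mapsto\sum_g e_g\otimes
  -- f(g\,\cdot)$. It is a unital *-morphism because the $e_g$ are orthogonal projections with sum
  -- $1$.
  let D : C(Y, ℂ) →⋆ₐ[ℂ] τ.tensor C(M, ℂ) C(Y, ℂ) :=
    { toFun := fun f => ∑ g, τ.tmul (e g) (f.comp (α g))
      map_one' := by
        change ∑ g, τ.tmul (e g) 1 = 1
        rw [← TensorKind.sum_tmul, hone, TensorKind.tmul_one_one]
      map_zero' := by
        change ∑ g, τ.tmul (e g) 0 = 0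
        simp
      map_add' := fun f f' => by
        simp only [ContinuousMap.add_comp, ← TensorKind.inl_mul_inr, map_add, mul_add,
          Finset.sum_add_distrib]
      map_mul' := fun f f' => by
        rw [Finset.sum_mul_sum]
        refine Finset.sum_congr rfl fun g _ => ?_
        rw [Finset.sum_eq_single g]
        · rw [TensorKind.tmul_mul, he, if_pos rfl, ContinuousMap.mul_comp]
        · intro h _ hh
          rw [TensorKind.tmul_mul, he, if_neg hh.symm, TensorKind.zero_tmul]
        · simp
      commutes' := fun c => by
        have h (g : M) : (algebraMap ℂ C(Y, ℂ) c).comp (α g) = algebraMap ℂ C(Y, ℂ) c := rfl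
        simp only [h, ← TensorKind.sum_tmul, hone]
        rw [← TensorKind.inr_apply]
        exact AlgHomClass.commutes _ c
      map_star' := fun f => by
        simp only [star_sum, TensorKind.star_tmul, hse]
        rfl }
  refine ⟨D, fun f a b hab => ?_⟩
  change ∑ g, τ.tmul (e g) (f.comp (α g)) = _
  -- For fixed $g$ the hypothesis expands $f(g\,\cdot)$ in the $b_k$ with scalars $a_k(g)$; these
  -- are also the coordinates of $a_k$ in the basis $e_g$, so the two double sums agree.
  have h (g : M) : f.comp (α g) = ∑ k, a k g • b k := by
    ext y; simp [hab]
  have h' (k : κ) : τ.tmul (a k) (b k) = ∑ g, τ.tmul (e g) (a k g • b k) := by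
    rw [← TensorKind.inl_mul_inr]
    nth_rewrite 1 [hsum (a k)]
    simp [Finset.sum_mul, ← TensorKind.inl_mul_inr]
  simp_rw [h, h', TensorKind.tmul_sum]
  exact Finset.sum_comm

variable {N d : ℕ}

/-- A signed permutation permutes the coordinates up to sign: the norm is kept, and a product over
distinct indices becomes, up to sign, another such product. -/
theorem hyperoctahedralGroup.mulVec_mem (U : hyperoctahedralGroup N)
    {x : EuclideanSpace ℝ (Fin N)} (hx : x ∈ polygonalSphereSet N d) :
    WithLp.toLp 2 (U.1.mulVec x.ofLp) ∈ polygonalSphereSet N d := by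
  obtain ⟨U, σ, ε, hU⟩ := U
  obtain ⟨hx, hp⟩ := hx
  have h (i : Fin N) : U.mulVec x.ofLp i = ((ε i : ℤ) : ℝ) * x (σ⁻¹ i) := by
    rw [hU, Matrix.mulVec, dotProduct, Finset.sum_eq_single (σ⁻¹ i)]
    · simp
    · intro k _ hk
      rw [Matrix.of_apply, if_neg, zero_mul]
      rintro rfl; simp at hk
    · simp
  have hε (i : Fin N) : ((ε i : ℤ) : ℝ) ^ 2 = 1 := by
    rcases Int.units_eq_one_or (ε i) with h | h <;> simp [h]
  refine ⟨?_, fun i hi => ?_⟩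
  · rw [← hx, EuclideanSpace.norm_eq, EuclideanSpace.norm_eq]
    congr 1
    simp only [h, Real.norm_eq_abs, sq_abs, mul_pow, hε, one_mul]
    exact Equiv.sum_comp σ⁻¹ fun i => x i ^ 2
  · simp only [h, Finset.prod_mul_distrib]
    rw [hp (fun k => σ⁻¹ (i k)) (σ⁻¹.injective.comp hi), mul_zero]

/-- The action of the hyperoctahedral group on the polygonal sphere. -/
def hyperoctahedralGroup.act (U : hyperoctahedralGroup N) :
    C(polygonalSphereSet N d, polygonalSphereSet N d) where
  toFun x := ⟨WithLp.toLp 2 (U.1.mulVec x.1.ofLp), mulVec_mem U x.2⟩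
  continuous_toFun := by
    refine Continuous.subtype_mk ((PiLp.continuous_toLp 2 _).comp ?_) _
    exact continuous_const.matrix_mulVec ((PiLp.continuous_ofLp 2 _).comp continuous_subtype_val)

theorem hyperoctahedral_actsOn_polygonalSphere (τ : TensorKind) (N d : ℕ) :
    (hyperoctahedral τ N).ActsOn (polygonalSphere N d) := by
  obtain ⟨Φ, hΦ⟩ := exists_coaction_finite τ (hyperoctahedralGroup N) (polygonalSphereSet N d)
    hyperoctahedralGroup.act (κ := Fin N)
  refine ⟨Φ, fun i => hΦ _ _ _ fun U x => ?_⟩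
  -- The value of the coordinate $x_i$ at the point $Ux$ is $\sum_k U_{ik}x_k$.
  change (((U.1.mulVec x.1.ofLp i : ℝ)) : ℂ) = ∑ k, ((U.1 i k : ℝ) : ℂ) * ((x.1 k : ℝ) : ℂ)
  simp [Matrix.mulVec, dotProduct]

end classical

/-! ### The actions on the universal polygonal spheres -/

theorem hyperoctahedral_actsOn_twistedPolygonalSphere (τ : TensorKind) (N d : ℕ) :
    (hyperoctahedral τ N).ActsOn (twistedPolygonalSphere N d) := by
  refine QuantumSubgroup.actsOn_ofRel _ ?_
  rintro P (⟨i, j, hij, rfl⟩ | hP)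
  · have h := QuantumSubgroup.coact_anticomm (hyperoctahedral_isCubic τ N)
      (hyperoctahedral_comm τ N) (S := .ofRel _) (fun i j hij => by
        have := SphereSubspace.eval_eq_zero (R := anticommRel N ∪ polygonalRel N d)
          (Or.inl ⟨i, j, hij, rfl⟩)
        simpa [← eq_neg_iff_add_eq_zero] using this) hij
    simpa [← eq_neg_iff_add_eq_zero] using h
  · exact QuantumSubgroup.eval_coact_polygonal (hyperoctahedral_isCubic τ N)
      (hyperoctahedral_hasCommutingSquares τ N) Set.subset_union_right hP

theorem halfHyperoctahedral_actsOn_halfPolygonalSphere (τ : TensorKind) (N d : ℕ) :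
    (halfHyperoctahedral τ N).ActsOn (halfPolygonalSphere N d) := by
  have hG := halfHyperoctahedral_halfCommutes τ N
  refine QuantumSubgroup.actsOn_ofRel _ ?_
  rintro P (⟨i, j, k, rfl⟩ | hP)
  · have h := QuantumSubgroup.coact_halfComm hG (S := .ofRel _) (fun i j k => by
        have := SphereSubspace.eval_eq_zero (R := halfCommRel (Fin N) ∪ polygonalRel N d)
          (Or.inl ⟨i, j, k, rfl⟩)
        simpa [sub_eq_zero] using this) i j k
    simpa [sub_eq_zero] using h
  · exact QuantumSubgroup.eval_coact_polygonal (halfHyperoctahedral_isCubic τ N)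
      hG.hasCommutingSquares Set.subset_union_right hP

theorem halfHyperoctahedral_actsOn_twistedHalfPolygonalSphere (τ : TensorKind) (N d : ℕ) :
    (halfHyperoctahedral τ N).ActsOn (twistedHalfPolygonalSphere N d) := by
  have hG := halfHyperoctahedral_halfCommutes τ N
  have h0 := halfHyperoctahedral_isCubic τ N
  refine QuantumSubgroup.actsOn_ofRel _ ?_
  rintro P ((⟨i, j, k, hijk, rfl⟩ | ⟨i, j, k, hijk, rfl⟩) | hP)
  · have h := QuantumSubgroup.coact_twistedHalfComm h0 hG (S := .ofRel _)
      (fun i j k hijk => by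
        have := SphereSubspace.eval_eq_zero (R := twistedHalfCommRel N ∪ polygonalRel N d)
          (Or.inl (Or.inl ⟨i, j, k, hijk, rfl⟩))
        simpa [← eq_neg_iff_add_eq_zero] using this) hijk
    simpa [← eq_neg_iff_add_eq_zero] using h
  · have h := QuantumSubgroup.coact_twistedHalfComm' h0 hG (S := .ofRel _)
      (fun i j k hijk => by
        have := SphereSubspace.eval_eq_zero (R := twistedHalfCommRel N ∪ polygonalRel N d)
          (Or.inl (Or.inr ⟨i, j, k, hijk, rfl⟩))
        simpa [sub_eq_zero] using this) hijk
    simpa [sub_eq_zero] using h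
  · exact QuantumSubgroup.eval_coact_polygonal h0 hG.hasCommutingSquares
      Set.subset_union_right hP

/-- Beyond the sphere relation only $(P_d)$ is imposed here, so the argument on words is the whole
proof. -/
theorem higherHyperoctahedral_actsOn_freePolygonalSphere (τ : TensorKind) (N d : ℕ) :
    (higherHyperoctahedral τ N).ActsOn (freePolygonalSphere N d) :=
  QuantumSubgroup.actsOn_ofRel _ fun _ hP =>
    QuantumSubgroup.eval_coact_polygonal (higherHyperoctahedral_isCubic τ N)
      (higherHyperoctahedral_hasCommutingSquares τ N) subset_rfl hP

theorem theorem4p5 (τ : TensorKind) (N d : ℕ) (hd : 2 ≤ d) :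
    (hyperoctahedral τ N).ActsOn (polygonalSphere N d) ∧
    (hyperoctahedral τ N).ActsOn (twistedPolygonalSphere N d) ∧
    (halfHyperoctahedral τ N).ActsOn (halfPolygonalSphere N d) ∧
    (halfHyperoctahedral τ N).ActsOn (twistedHalfPolygonalSphere N d) ∧
    (higherHyperoctahedral τ N).ActsOn (freePolygonalSphere N d) := by
  exact ⟨hyperoctahedral_actsOn_polygonalSphere τ N d,
    hyperoctahedral_actsOn_twistedPolygonalSphere τ N d,
    halfHyperoctahedral_actsOn_halfPolygonalSphere τ N d,
    halfHyperoctahedral_actsOn_twistedHalfPolygonalSphere τ N d,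
    higherHyperoctahedral_actsOn_freePolygonalSphere τ N d⟩
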